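/- Let $G$ be a group generated by $g_1,\dots,g_n$, acting on $\ell^2(G)$ (complex coefficients, standard basis $\zeta_h$, $h\in G$) by $g\cdot\zeta_h=\zeta_{gh}$; thus $\mathbb{C}G$ acts on $\ell^2(G)$ by bounded operators. For a bounded operator $A$ on $\ell^2(G)$ let $\mathrm{tr}_{vN}(A)=\langle A\zeta_e,\zeta_e\rangle$, and for a bounded operator $A=(A_{ij})$ on $\ell^2(G)^m$ let $\mathrm{tr}_{vN}(A)=\sum_{i}\mathrm{tr}_{vN}(A_{ii})$. The spectral measure of a self-adjoint $T\in M_m(\mathbb{Q}G)$, acting on $\ell^2(G)^m$, is the Borel measure $\mu_T$ on $\mathbb{R}$ with $\int f\,d\mu_T=\mathrm{tr}_{vN}(f(T))$ for all $f\in C_c(\mathbb{R})$. Suppose that: 1. $G$ is sofic: for each finitely generated subgroup $H$ there is a finite sequence $h_1,\dots,h_r$ generating $H$ such that for all $\varepsilon>0$ and $R\in\mathbb{N}$ there is a non-empty finite directed graph $K$ with edges labelled by the symbols $h_i^{\pm1}$, where each label occurs at most once as an out-label and at most once as an in-label at each vertex and the edges labelled $h_i^{-1}$ are the reversed edges labelled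 $h_i$, such that for at least $(1-\varepsilon)|V(K)|$ vertices $v$ the ball of radius $R$ around $v$ in $K$ is isomorphic, as a rooted labelled graph, to the ball of radius $R$ around $e$ in the Cayley diagram of $H$ with respect to the sequence $h_1^{\pm1},\dots,h_r^{\pm1}$. 2. $G$ satisfies the Atiyah conjecture over $\mathbb{Q}$: there is an integer $k\ge1$ such that for every $m$, every self-adjoint $T\in M_m(\mathbb{Q}G)$ and every $x\in\mathbb{R}$ we have $k\cdot\mu_T(\{x\})\in\mathbb{Z}$. (Call such a $k$ an atom denominator for $G$.) 3. The word problem of $G$ is decidable: there is an algorithm that decides whether a word in the letters $g_i^{\pm1}$ represents the neutral element. Then the $\ell^2$-zero-divisor problem for $G$ is decidable: there is an algorithm which, given a word $w$ in the letters $g_i^{\pm1}$ and the symbols $+$ and $-$, decides whether the element of $\mathbb{Z}G$ represented by $w$ (also denoted by $w$) satisfies $wv=0$ for some non-zero $v\in\ell^2(G)$. Moreover, let $|w|$ be the sum of the absolute values of the coefficients of $w\in\mathbb{Z}G$, and let $T_w=|w|^{-2}w^*w$ (with $T_w=0$ if $w=0$). Let $k$ be an atom denominator for $G$. Then there is a computable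 function $w\mapsto N(w)\ge 2$ with $$\frac{3|w|^2}{\log N(w)}<\frac1{3k}$$ for all $w$, such that the numbers $\mathrm{tr}_{vN}\bigl((1-T_w)^{N(w)}\bigr)$ are non-negative rationals that can be computed from the word $w$ (as a quotient of two natural numbers, the second one positive), and for every $w$ the element $w$ is an $\ell^2$-zero-divisor if and only if $\mathrm{tr}_{vN}\bigl((1-T_w)^{N(w)}\bigr)>\frac1{3k}$. -/

import Mathlib

open MeasureTheory
open scoped InnerProductSpace CompactlySupported

noncomputable section

namespace GroupL2

universe u

/-! ### Spectral measures -/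

section Spectral

variable {H : Type*} [NormedAddCommGroup H] [InnerProductSpace ℂ H] [CompleteSpace H]
  {ι : Type*} [Fintype ι]

/-- The functional `A ↦ ∑ i, ⟨A ξ_i, ξ_i⟩` on bounded operators. -/
def vectorTrace (ξ : ι → H) (A : H →L[ℂ] H) : ℂ := ∑ i, ⟪ξ i, A (ξ i)⟫_ℂ

/-- The positive functional `f ↦ ∑ i, ⟨f(A) ξ_i, ξ_i⟩` on `C_c(ℝ)`, for `A` self-adjoint, where
`f(A)` is given by the continuous functional calculus. -/
def spectralFunctional (ξ : ι → H) (A : H →L[ℂ] H) : C_c(ℝ, ℝ) →ₚ[ℝ] ℝ :=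
  PositiveLinearMap.mk₀
    { toFun := fun f => (vectorTrace ξ (cfc (fun x => f x) A)).re
      map_add' := fun f g => by
        have h : cfc (fun x => (f + g) x) A = cfc (fun x => f x) A + cfc (fun x => g x) A :=
          cfc_add A (fun x => f x) (fun x => g x) f.continuous.continuousOn
            g.continuous.continuousOn
        rw [h]
        simp [vectorTrace, Finset.sum_add_distrib]
      map_smul' := fun r f => by
        have h : cfc (fun x => (r • f) x) A = r • cfc (fun x => f x) A :=
          cfc_smul r (fun x => f x) A f.continuous.continuousOn
        rw [h]
        simp [vectorTrace, inner_smul_right_eq_smul, Finset.mul_sum] }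
    (fun f hf => by
      have h : 0 ≤ cfc (fun x => f x) A := cfc_nonneg fun x _ => hf x
      have h' := (ContinuousLinearMap.nonneg_iff_isPositive _).mp h
      simp only [LinearMap.coe_mk, AddHom.coe_mk, vectorTrace, Complex.re_sum]
      exact Finset.sum_nonneg fun i _ => h'.re_inner_nonneg_right _)

/-- The spectral measure of a self-adjoint operator `A` with respect to the functional
`vectorTrace ξ`: the Borel measure `μ` on `ℝ` with `∫ f dμ = ∑ i, ⟨f(A) ξ_i, ξ_i⟩`. -/
def spectralMeasure (ξ : ι → H) (A : H →L[ℂ] H) : Measure ℝ :=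
  RealRMK.rieszMeasure (spectralFunctional ξ A)

end Spectral

/-! ### The Hilbert space `ℓ²(G)` and the left regular representation -/

/-- The complex Hilbert space `ℓ²(G)` of square-summable functions `G → ℂ`. -/
abbrev L2 (G : Type u) : Type u := lp (fun _ : G => ℂ) 2

section Regular

variable {G : Type u} [Group G]

/-- The standard basis vector `ζ_g` of `ℓ²(G)`. -/
def zeta (g : G) : L2 G := by
  classical exact lp.single 2 g (1 : ℂ)

theorem memlp_translate (g : G) (f : L2 G) :
    Memℓp (fun h : G => (f : G → ℂ) (g⁻¹ * h)) 2 := by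
  have hp : 0 < (2 : ENNReal).toReal := by norm_num
  have hs := (lp.memℓp f).summable hp
  exact memℓp_gen ((Equiv.mulLeft g⁻¹).summable_iff.mpr hs)

/-- Left translation by `g` as a linear isometry of `ℓ²(G)`: `(g f)(h) = f(g⁻¹ h)`, so that
`g ζ_h = ζ_{gh}`. -/
def translate (g : G) : L2 G →ₗᵢ[ℂ] L2 G where
  toFun f := ⟨fun h => (f : G → ℂ) (g⁻¹ * h), memlp_translate g f⟩
  map_add' _ _ := rfl
  map_smul' _ _ := rfl
  norm_map' f := by
    have hp : 0 < (2 : ENNReal).toReal := by norm_num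
    rw [lp.norm_eq_tsum_rpow hp, lp.norm_eq_tsum_rpow hp]
    congr 1
    exact (Equiv.mulLeft g⁻¹).tsum_eq (fun h => ‖(f : G → ℂ) h‖ ^ (2 : ENNReal).toReal)

/-- The left regular representation of `G` on `ℓ²(G)`. -/
def regularRep : G →* (L2 G →L[ℂ] L2 G) where
  toFun g := (translate g).toContinuousLinearMap
  map_one' := by
    ext f h
    change (f : G → ℂ) (1⁻¹ * h) = (f : G → ℂ) h
    simp
  map_mul' a b := by
    ext f h
    change (f : G → ℂ) ((a * b)⁻¹ * h) = (f : G → ℂ) (b⁻¹ * (a⁻¹ * h))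
    rw [mul_inv_rev, mul_assoc]

/-- The action of the complex group ring on `ℓ²(G)` by bounded operators. -/
def groupRingRep : MonoidAlgebra ℂ G →ₐ[ℂ] (L2 G →L[ℂ] L2 G) :=
  MonoidAlgebra.lift ℂ (L2 G →L[ℂ] L2 G) G regularRep

/-- The action of an element of the integral group ring on `ℓ²(G)`. -/
def intOp (a : MonoidAlgebra ℤ G) : L2 G →L[ℂ] L2 G :=
  groupRingRep (MonoidAlgebra.mapRingHom G (Int.castRingHom ℂ) a)

/-- The action of an element of the rational group ring on `ℓ²(G)`. -/
def ratOp (a : MonoidAlgebra ℚ G) : L2 G →L[ℂ] L2 G :=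
  groupRingRep (MonoidAlgebra.mapRingHom G (algebraMap ℚ ℂ) a)

/-- The von Neumann trace `⟨A ζ_e, ζ_e⟩` of a bounded operator on `ℓ²(G)`. -/
def vnTrace (A : L2 G →L[ℂ] L2 G) : ℂ := ⟪zeta (1 : G), A (zeta 1)⟫_ℂ

/-- `a ∈ ℤG` is an `ℓ²`-zero-divisor if `a v = 0` for some non-zero `v ∈ ℓ²(G)`. -/
def IsL2ZeroDivisor (a : MonoidAlgebra ℤ G) : Prop :=
  ∃ v : L2 G, v ≠ 0 ∧ intOp a v = 0

/-- The sum of the absolute values of the coefficients of `a`. -/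
def coeffNorm (a : MonoidAlgebra ℤ G) : ℕ := a.coeff.sum fun _ c => c.natAbs

/-- The positive contraction `|a|⁻² a* a` on `ℓ²(G)`, where `|a|` is the sum of the absolute values
of the coefficients of `a` (for `a = 0` it is the operator `0`). -/
def normalizedSquare (a : MonoidAlgebra ℤ G) : L2 G →L[ℂ] L2 G :=
  (((coeffNorm a : ℂ) ^ 2)⁻¹) • (star (intOp a) * intOp a)

/-! ### Matrices over the rational group ring, the Atiyah conjecture -/

variable (G) in
/-- The Hilbert space `ℓ²(G)^m`. -/
abbrev L2Pow (m : ℕ) : Type u := PiLp 2 (fun _ : Fin m => L2 G)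

/-- The bounded operator on `ℓ²(G)^m` given by a matrix over the rational group ring:
`(T v)_i = ∑ j, T_ij v_j`. -/
def matrixOp {m : ℕ} (T : Matrix (Fin m) (Fin m) (MonoidAlgebra ℚ G)) :
    L2Pow G m →L[ℂ] L2Pow G m :=
  ((PiLp.continuousLinearEquiv 2 ℂ (fun _ : Fin m => L2 G)).symm :
      (Fin m → L2 G) →L[ℂ] L2Pow G m).comp
    (ContinuousLinearMap.pi fun i =>
      ∑ j, (ratOp (T i j)).comp (PiLp.proj 2 (fun _ : Fin m => L2 G) j))

/-- The standard vectors of `ℓ²(G)^m`: `ζ_e` in the `i`-th coordinate. -/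
def zetaPow {m : ℕ} (i : Fin m) : L2Pow G m :=
  WithLp.toLp 2 (Pi.single i (zeta (1 : G)))

/-- The spectral measure of a matrix over the rational group ring with self-adjoint operator, with
respect to the von Neumann trace `A ↦ ∑ i, ⟨A ζ_{e,i}, ζ_{e,i}⟩` (which is not normalized). -/
def matrixSpectralMeasure {m : ℕ} (T : Matrix (Fin m) (Fin m) (MonoidAlgebra ℚ G)) : Measure ℝ :=
  spectralMeasure (zetaPow (G := G)) (matrixOp T)

variable (G) in
/-- `k` is a common denominator for all atoms of the spectral measures of self-adjoint matrices
over the rational group ring of `G`. -/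
def IsAtomDenominator (k : ℕ) : Prop :=
  0 < k ∧ ∀ (m : ℕ) (T : Matrix (Fin m) (Fin m) (MonoidAlgebra ℚ G)),
    IsSelfAdjoint (matrixOp T) →
      ∀ x : ℝ, ∃ p : ℕ, matrixSpectralMeasure T {x} = (p : ENNReal) / (k : ENNReal)

variable (G) in
/-- The Atiyah conjecture for `G` (over `ℚ`): the atoms of spectral measures of matrices over the
rational group ring have a common denominator. -/
def SatisfiesAtiyah : Prop := ∃ k : ℕ, IsAtomDenominator G k

end Regular

/-! ### Sofic groups -/

/-- A directed graph with vertex set `V` and edges labelled by `L`, at most one edge of each label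
between two vertices. -/
structure LabelledGraph (L : Type*) (V : Type*) where
  /-- There is an edge with label `l` from `v` to `w`. -/
  edge : L → V → V → Prop

/-- The set of vertices at distance at most `R` from `v`. -/
def LabelledGraph.ball {L V : Type*} (K : LabelledGraph L V) (v : V) : ℕ → Set V
  | 0 => {v}
  | R + 1 => K.ball v R ∪ {w | ∃ u ∈ K.ball v R, ∃ l, K.edge l u w ∨ K.edge l w u}

/-- The balls of radius `R` around `v` in `K` and around `v'` in `K'` are isomorphic, as rooted
labelled graphs. -/
def LabelledGraph.BallsIso {L V V' : Type*} (K : LabelledGraph L V) (v : V)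
    (K' : LabelledGraph L V') (v' : V') (R : ℕ) : Prop :=
  ∃ φ : V → V', φ v = v' ∧ Set.BijOn φ (K.ball v R) (K'.ball v' R) ∧
    ∀ a ∈ K.ball v R, ∀ b ∈ K.ball v R, ∀ l, K.edge l a b ↔ K'.edge l (φ a) (φ b)

/-- The element of `G` denoted by a letter: `(i, true)` is `g_i` and `(i, false)` is `g_i⁻¹`. -/
def letter {G : Type u} [Group G] {n : ℕ} (g : Fin n → G) (x : Fin n × Bool) : G :=
  if x.2 then g x.1 else (g x.1)⁻¹

/-- The Cayley diagram with respect to the symmetric sequence `g_1, …, g_n, g_1⁻¹, …, g_n⁻¹`: an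
edge with label `x` from `a` to `b` whenever `a * x = b`. -/
def cayleyDiagram {G : Type u} [Group G] {n : ℕ} (g : Fin n → G) :
    LabelledGraph (Fin n × Bool) G where
  edge x a b := a * letter g x = b

/-- Admissible graphs for sofic approximations: every label occurs at most once as an out-label and
at most once as an in-label at each vertex, and the edges labelled `g_i⁻¹` are the reversed
edges labelled `g_i`. -/
def LabelledGraph.IsAdmissible {n : ℕ} {V : Type*} (K : LabelledGraph (Fin n × Bool) V) : Prop :=
  (∀ x v w w', K.edge x v w → K.edge x v w' → w = w') ∧
  (∀ x v v' w, K.edge x v w → K.edge x v' w → v = v') ∧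
  (∀ i b v w, K.edge (i, b) v w ↔ K.edge (i, !b) w v)

/-- For all `ε > 0` and `R` there is an `(ε, R)`-sofic approximation with respect to the symmetric
sequence `g_1, …, g_n, g_1⁻¹, …, g_n⁻¹`: a non-empty finite admissible graph in which at
least `(1 - ε) |V|` vertices `v` have `R`-ball isomorphic to the `R`-ball around `e` in the
Cayley diagram. -/
def HasSoficApproximations {G : Type u} [Group G] {n : ℕ} (g : Fin n → G) : Prop :=
  ∀ (ε : ℝ), 0 < ε → ∀ R : ℕ, ∃ (N : ℕ) (K : LabelledGraph (Fin n × Bool) (Fin N)),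
    0 < N ∧ K.IsAdmissible ∧
      (1 - ε) * (N : ℝ) ≤ (Set.ncard {v | (cayleyDiagram g).BallsIso 1 K v R} : ℝ)

/-- A group is sofic if each of its finitely generated subgroups `H` has sofic approximations with
respect to a finite generating sequence. (The connected component of `e` in the Cayley diagram
on `G` of a sequence in `H` generating `H` is the Cayley diagram of `H`.) -/
def IsSofic (G : Type u) [Group G] : Prop :=
  ∀ H : Subgroup G, H.FG → ∃ (n : ℕ) (h : Fin n → G),
    Subgroup.closure (Set.range h) = H ∧ HasSoficApproximations h

/-! ### Words and decision problems -/

section Words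

variable {G : Type u} [Group G] {n : ℕ}

/-- The word problem of `G` for the generators `g` is decidable: there is an algorithm that
decides whether a word in the letters `g_i^{±1}` is trivial in `G`. -/
def WordProblemDecidable (g : Fin n → G) : Prop :=
  ComputablePred fun w : List (Fin n × Bool) => (w.map (letter g)).prod = 1

/-- The symbols for words representing elements of the integral group ring: the letters
`g_i^{±1}`, the symbol `+` (as `Sum.inr true`) and the symbol `-` (as `Sum.inr false`). -/
abbrev RingSymbol (n : ℕ) : Type := (Fin n × Bool) ⊕ Bool

/-- Reads a word from left to right. `s` is the sign of the summand being read; `b` is the product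
of its letters so far, or `none` if no letter has been read. Signs in a row multiply; a summand
without letters contributes nothing. -/
def readWord (g : Fin n → G) : ℤ → Option G → List (RingSymbol n) → MonoidAlgebra ℤ G
  | _, none, [] => 0
  | s, some h, [] => MonoidAlgebra.single h s
  | s, none, Sum.inl x :: w => readWord g s (some (letter g x)) w
  | s, some h, Sum.inl x :: w => readWord g s (some (h * letter g x)) w
  | s, none, Sum.inr t :: w => readWord g (s * if t then 1 else -1) none w
  | s, some h, Sum.inr t :: w =>
      MonoidAlgebra.single h s + readWord g (if t then 1 else -1) none w

/-- The element of the integral group ring represented by a word. -/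
def wordValue (g : Fin n → G) (w : List (RingSymbol n)) : MonoidAlgebra ℤ G :=
  readWord g 1 none w

end Words

end GroupL2

end

/-!
# Decidability of the `ℓ²`-zero-divisor problem

Let `M = |a|²` and `T = M⁻¹ a* a`, a positive contraction on `ℓ²(G)`. The traces of `(1 - T)^N`
decrease to the mass of the spectral measure of `T` at `0`, which is positive exactly when `a` has a
non-trivial kernel. The point is to find a computable `N` for which the trace of `(1 - T)^N` already
tells whether this mass is zero.

If `a` is a zero-divisor, a kernel vector gives a positive atom at `0` of the spectral measure of
`a* a`. By the Atiyah conjecture its mass is at least `1/k`, and it bounds every trace of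
`(1 - T)^N` from below (`inv_le_complementTrace`).

If `a` has trivial kernel, the traces must be bounded from above. In a sofic approximation, `a` acts
by an integral matrix `A` of norm at most `|a|`. The product of the non-zero eigenvalues of `AᵀA` is
a positive integer (`one_le_prod_eigenvalues`), so few of them are small, and this gives a bound on
the difference of the normalized traces of the `N`-th and `j`-th powers of `1 - M⁻¹ AᵀA` by
`log M / log (1/ε) + (1 - ε)^N`, for all `j` (`trace_pow_sub_trace_pow_le`). The bound passes to the
limit along sofic approximations (`complementTrace_sub_le`). The mean over `j` of the traces of
`(1 - T)^j` tends to zero by von Neumann's mean ergodic theorem, since `1 - T` has no fixed vectors,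
and what remains is an upper bound for the trace of `(1 - T)^N` (`complementTrace_le`). For an
explicit `N` depending on `k` and on an upper bound for `|a|` it is at most `1/(3k)`
(`complementTrace_exponent_le`).

Finally, the trace of `(1 - T)^N` is `M^(-N)` times the coefficient of the neutral element in
`(M - a* a)^N`. Elements of the integral group ring are handled as lists of signed words, and the
word problem serves to count trivial words and to find the coefficient norm `|a|`
(`exists_computable_trace`).
-/

noncomputable section

namespace GroupL2

universe u

/-! ### The group ring as operators on `ℓ²(G)` -/

section Ops
variable {G : Type u}

theorem inner_zeta_left (g : G) (f : L2 G) : ⟪zeta g, f⟫_ℂ = (f : G → ℂ) g := by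
  classical
  have h : zeta g = lp.single 2 g (1 : ℂ) := by
    unfold zeta; congr!
  rw [h, lp.inner_single_left]
  simp

theorem zeta_apply [DecidableEq G] (g h : G) :
    (zeta g : G → ℂ) h = if h = g then 1 else 0 := by
  have e : zeta g = lp.single 2 g (1 : ℂ) := by
    unfold zeta; congr!
  rw [e, lp.single_apply]
  split_ifs with h1
  · subst h1; simp
  · simp [h1]

variable [Group G]

theorem norm_regularRep_apply (g : G) (f : L2 G) : ‖regularRep g f‖ = ‖f‖ :=
  (translate g).norm_map f

theorem star_regularRep (g : G) : star (regularRep g) = regularRep (G := G) g⁻¹ := by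
  rw [ContinuousLinearMap.star_eq_adjoint, eq_comm, ContinuousLinearMap.eq_adjoint_iff]
  intro x y
  have h := (translate g).inner_map_map (regularRep g⁻¹ x) y
  have e : translate g (regularRep g⁻¹ x) = x := by
    change (regularRep g * regularRep g⁻¹) x = x
    rw [← map_mul]; simp
  rw [e] at h
  exact h.symm

/-- The action of the integral group ring on `ℓ²(G)` as a ring homomorphism. -/
def intOpHom : MonoidAlgebra ℤ G →+* (L2 G →L[ℂ] L2 G) :=
  (groupRingRep (G := G) : MonoidAlgebra ℂ G →+* (L2 G →L[ℂ] L2 G)).comp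
    (MonoidAlgebra.mapRingHom G (Int.castRingHom ℂ))

theorem intOpHom_apply (a : MonoidAlgebra ℤ G) : intOpHom a = intOp a := rfl

theorem intOp_single (g : G) (c : ℤ) :
    intOp (MonoidAlgebra.single g c) = (c : ℂ) • regularRep g := by
  simp [intOp, groupRingRep]

theorem intOp_eq_sum (a : MonoidAlgebra ℤ G) :
    intOp a = a.coeff.sum fun g c => (c : ℂ) • regularRep g := by
  conv_lhs => rw [← MonoidAlgebra.sum_coeff_single a]
  rw [← intOpHom_apply, Finsupp.sum, map_sum]
  simp only [intOpHom_apply, intOp_single]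
  rfl

theorem norm_intOp_le (a : MonoidAlgebra ℤ G) : ‖intOp a‖ ≤ coeffNorm a := by
  rw [intOp_eq_sum, coeffNorm, Finsupp.sum, Finsupp.sum]
  push_cast
  refine (norm_sum_le _ _).trans (Finset.sum_le_sum fun g _ => ?_)
  rw [norm_smul]
  have h1 : ‖(regularRep g : L2 G →L[ℂ] L2 G)‖ ≤ 1 :=
    ContinuousLinearMap.opNorm_le_bound _ zero_le_one fun f => by
      rw [norm_regularRep_apply, one_mul]
  have h2 : ‖((a.coeff g : ℤ) : ℂ)‖ = ((a.coeff g).natAbs : ℝ) := by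
    rw [Complex.norm_intCast, Nat.cast_natAbs, Int.cast_abs]
  rw [h2]
  exact mul_le_of_le_one_right (Nat.cast_nonneg _) h1

theorem vnTrace_intOp (a : MonoidAlgebra ℤ G) : vnTrace (intOp a) = (a.coeff 1 : ℂ) := by
  classical
  rw [vnTrace, intOp_eq_sum, Finsupp.sum, _root_.sum_apply, inner_sum]
  have h (g : G) : ⟪zeta (1 : G), ((a.coeff g : ℂ) • regularRep g : L2 G →L[ℂ] L2 G) (zeta 1)⟫_ℂ
      = if g = 1 then (a.coeff g : ℂ) else 0 := by
    rw [inner_zeta_left]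
    change (a.coeff g : ℂ) * (zeta (1 : G) : G → ℂ) (g⁻¹ * 1) = _
    rw [zeta_apply]
    simp
  simp only [h]
  rw [Finset.sum_ite_eq']
  split_ifs with h1
  · rfl
  · simp [Finsupp.notMem_support_iff.mp h1]

/-- The involution `∑ c_g g ↦ ∑ c_g g⁻¹` of the integral group ring. -/
def involution : MonoidAlgebra ℤ G →+ MonoidAlgebra ℤ G where
  toFun a := a.coeff.sum fun g c => MonoidAlgebra.single g⁻¹ c
  map_zero' := by simp
  map_add' a b := by
    rw [MonoidAlgebra.coeff_add]
    exact Finsupp.sum_add_index' (by simp) (by simp)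

theorem involution_apply (a : MonoidAlgebra ℤ G) :
    involution a = a.coeff.sum fun g c => MonoidAlgebra.single g⁻¹ c := rfl

theorem involution_single (g : G) (c : ℤ) :
    involution (MonoidAlgebra.single g c) = MonoidAlgebra.single g⁻¹ c := by
  rw [involution_apply, MonoidAlgebra.coeff_single, Finsupp.sum_single_index]
  simp

theorem star_intOp (a : MonoidAlgebra ℤ G) : star (intOp a) = intOp (involution a) := by
  rw [involution_apply, ← intOpHom_apply, ← intOpHom_apply, Finsupp.sum, map_sum]
  rw [intOpHom_apply, intOp_eq_sum, Finsupp.sum, star_sum]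
  simp only [intOpHom_apply, intOp_single, star_smul, star_regularRep]
  simp

/-- Right translation by `g`: `(f g)(h) = f(h g)`. It commutes with the left action of the group
ring. -/
def rightTranslate (g : G) (f : L2 G) : L2 G :=
  ⟨fun h => (f : G → ℂ) (h * g), by
    have hp : 0 < (2 : ENNReal).toReal := by norm_num
    have hs := (lp.memℓp f).summable hp
    exact memℓp_gen ((Equiv.mulRight g).summable_iff.mpr hs)⟩

theorem rightTranslate_apply (g : G) (f : L2 G) (h : G) :
    (rightTranslate g f : G → ℂ) h = (f : G → ℂ) (h * g) := rfl

theorem intOp_apply (a : MonoidAlgebra ℤ G) (f : L2 G) (h : G) :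
    (intOp a f : G → ℂ) h = a.coeff.sum fun g c => (c : ℂ) * (f : G → ℂ) (g⁻¹ * h) := by
  rw [intOp_eq_sum, Finsupp.sum, _root_.sum_apply, lp.coeFn_sum, Finset.sum_apply]
  rfl

theorem intOp_rightTranslate (a : MonoidAlgebra ℤ G) (g : G) (f : L2 G) :
    intOp a (rightTranslate g f) = rightTranslate g (intOp a f) := by
  ext h
  rw [intOp_apply, rightTranslate_apply, intOp_apply]
  simp only [rightTranslate_apply, mul_assoc]

/-- By right translation, a kernel vector can be moved so that it is non-zero at `e`. -/
theorem IsL2ZeroDivisor.exists_apply_one_ne_zero {a : MonoidAlgebra ℤ G}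
    (h : IsL2ZeroDivisor a) : ∃ v : L2 G, intOp a v = 0 ∧ (v : G → ℂ) 1 ≠ 0 := by
  obtain ⟨v, hv, hav⟩ := h
  obtain ⟨g, hg⟩ : ∃ g, (v : G → ℂ) g ≠ 0 := by
    by_contra! hc
    exact hv (by ext g; simpa using hc g)
  refine ⟨rightTranslate g v, ?_, by simpa [rightTranslate_apply] using hg⟩
  rw [intOp_rightTranslate, hav]
  rfl

end Ops

/-! ### Atoms of spectral measures as limits of traces -/

section Atoms
open Filter Topology

variable {H : Type*} [NormedAddCommGroup H] [InnerProductSpace ℂ H] [CompleteSpace H]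
  {ι : Type*} [Fintype ι]

/-- The compactly supported function `x ↦ max(0, 1 - |x|/M)^(N+1)`. -/
def tentPow {M : ℝ} (hM : 0 < M) (N : ℕ) : C_c(ℝ, ℝ) where
  toFun x := (max 0 (1 - |x| / M)) ^ (N + 1)
  continuous_toFun := by fun_prop
  hasCompactSupport' := by
    refine HasCompactSupport.intro (isCompact_Icc (a := -M) (b := M)) fun x hx => ?_
    have h : M < |x| := by
      by_contra! hc
      exact hx (abs_le.mp hc)
    have h1 : 1 - |x| / M ≤ 0 := by
      rw [sub_nonpos, le_div_iff₀ hM]; linarith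
    rw [max_eq_left h1]; simp

theorem tentPow_apply {M : ℝ} (hM : 0 < M) (N : ℕ) (x : ℝ) :
    tentPow hM N x = (max 0 (1 - |x| / M)) ^ (N + 1) := rfl

theorem cfc_tentPow {M : ℝ} (hM : 0 < M) (N : ℕ) {A : H →L[ℂ] H} (hA : 0 ≤ A)
    (hAM : ‖A‖ ≤ M) :
    cfc (fun x => tentPow hM N x) A = (1 - ((M⁻¹ : ℝ) : ℂ) • A) ^ (N + 1) := by
  have hsa : IsSelfAdjoint A := .of_nonneg hA
  have h1 : cfc (fun x => tentPow hM N x) A = cfc (fun x : ℝ => (1 - M⁻¹ • x) ^ (N + 1)) A := by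
    refine cfc_congr fun x hx => ?_
    have hx0 : 0 ≤ x := spectrum_nonneg_of_nonneg hA hx
    have hx1 : x ≤ M := by
      rcases subsingleton_or_nontrivial H with h | h
      · exact absurd hx (by simp [spectrum.of_subsingleton])
      · have := spectrum.norm_le_norm_of_mem hx
        rw [Real.norm_of_nonneg hx0] at this
        linarith
    have h2 : 0 ≤ 1 - x / M := by
      rw [sub_nonneg, div_le_one hM]; exact hx1
    simp only [tentPow_apply, abs_of_nonneg hx0, max_eq_right h2, smul_eq_mul]
    rw [div_eq_inv_mul]
  rw [h1, cfc_pow (fun x : ℝ => 1 - M⁻¹ • x) (N + 1) A,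
    cfc_sub (fun _ : ℝ => (1 : ℝ)) (fun x : ℝ => M⁻¹ • x) A, cfc_const_one ℝ A,
    cfc_smul_id (R := ℝ) M⁻¹ A, Complex.coe_smul]

theorem integral_tentPow (ξ : ι → H) {M : ℝ} (hM : 0 < M) (N : ℕ) {A : H →L[ℂ] H} (hA : 0 ≤ A)
    (hAM : ‖A‖ ≤ M) :
    ∫ x, tentPow hM N x ∂(spectralMeasure ξ A) =
      (vectorTrace ξ ((1 - ((M⁻¹ : ℝ) : ℂ) • A) ^ (N + 1))).re := by
  rw [spectralMeasure, RealRMK.integral_rieszMeasure, ← cfc_tentPow hM N hA hAM]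
  rfl

instance spectralMeasure_isFiniteMeasureOnCompacts (ξ : ι → H) (A : H →L[ℂ] H) :
    IsFiniteMeasureOnCompacts (spectralMeasure ξ A) := by
  unfold spectralMeasure; infer_instance

theorem integrable_tentPow (ξ : ι → H) {M : ℝ} (hM : 0 < M) (N : ℕ) (A : H →L[ℂ] H) :
    Integrable (tentPow hM N) (spectralMeasure ξ A) :=
  (tentPow hM N).continuous.integrable_of_hasCompactSupport (tentPow hM N).hasCompactSupport

theorem tentPow_zero {M : ℝ} (hM : 0 < M) (N : ℕ) : tentPow hM N 0 = 1 := by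
  simp [tentPow_apply]

theorem tentPow_nonneg {M : ℝ} (hM : 0 < M) (N : ℕ) (x : ℝ) : 0 ≤ tentPow hM N x := by
  rw [tentPow_apply]; positivity

theorem integral_indicator_zero (ξ : ι → H) (A : H →L[ℂ] H) :
    ∫ x, Set.indicator {0} (fun _ => (1 : ℝ)) x ∂(spectralMeasure ξ A) =
      (spectralMeasure ξ A).real {0} := by
  rw [integral_indicator (measurableSet_singleton 0), setIntegral_const, smul_eq_mul, mul_one]

theorem atom_le_vectorTrace (ξ : ι → H) {M : ℝ} (hM : 0 < M) (N : ℕ) {A : H →L[ℂ] H}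
    (hA : 0 ≤ A) (hAM : ‖A‖ ≤ M) :
    (spectralMeasure ξ A).real {0} ≤ (vectorTrace ξ ((1 - ((M⁻¹ : ℝ) : ℂ) • A) ^ (N + 1))).re := by
  rw [← integral_tentPow ξ hM N hA hAM, ← integral_indicator_zero]
  refine integral_mono_of_nonneg ?_ (integrable_tentPow ξ hM N A) ?_
  · exact Eventually.of_forall fun x => Set.indicator_nonneg (fun _ _ => zero_le_one) x
  · refine Eventually.of_forall fun x => ?_
    by_cases hx : x = 0
    · subst hx; simp [tentPow_zero]
    · simp [hx, tentPow_nonneg]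

/-- The traces of the powers of `1 - A/M` converge to the mass of the atom at `0`. -/
theorem tendsto_vectorTrace_pow (ξ : ι → H) {M : ℝ} (hM : 0 < M) {A : H →L[ℂ] H}
    (hA : 0 ≤ A) (hAM : ‖A‖ ≤ M) :
    Tendsto (fun N : ℕ => (vectorTrace ξ ((1 - ((M⁻¹ : ℝ) : ℂ) • A) ^ (N + 1))).re) atTop
      (𝓝 ((spectralMeasure ξ A).real {0})) := by
  simp only [← integral_tentPow ξ hM _ hA hAM]
  rw [← integral_indicator_zero]
  refine tendsto_integral_of_dominated_convergence (tentPow hM 0)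
    (fun N => (integrable_tentPow ξ hM N A).aestronglyMeasurable) (integrable_tentPow ξ hM 0 A)
    (fun N => Eventually.of_forall fun x => ?_) (Eventually.of_forall fun x => ?_)
  · rw [Real.norm_of_nonneg (tentPow_nonneg hM N x), tentPow_apply, tentPow_apply]
    refine pow_le_pow_of_le_one (le_max_left _ _) (max_le zero_le_one ?_) (by omega)
    have : 0 ≤ |x| / M := by positivity
    linarith
  · by_cases hx : x = 0
    · subst hx; simp [tentPow_zero]
    · rw [Set.indicator_of_notMem (by simpa using hx)]
      have h0 : 0 < |x| / M := by positivity
      exact (tendsto_pow_atTop_nhds_zero_of_lt_one (le_max_left 0 (1 - |x| / M))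
        (max_lt zero_lt_one (by linarith))).comp (tendsto_add_atTop_nat 1)

end Atoms

/-! ### Small eigenvalues of integral Gram matrices -/

section IntegerMatrices
open Matrix Polynomial
open scoped Matrix.Norms.L2Operator
variable {V : Type*} [Fintype V] [DecidableEq V]

theorem trace_one_sub_smul_pow {S : Matrix V V ℝ} (hS : S.IsHermitian) (c : ℝ) (N : ℕ) :
    ((1 - c • S) ^ N).trace = ∑ i, (1 - c * hS.eigenvalues i) ^ N := by
  have h : (1 - c • S) ^ N = Unitary.conjStarAlgAut ℝ _ hS.eigenvectorUnitary
      (diagonal fun i => (1 - c * hS.eigenvalues i) ^ N) := by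
    have h1 : (diagonal fun i => (1 - c * hS.eigenvalues i) ^ N) =
        (1 - c • diagonal (RCLike.ofReal ∘ hS.eigenvalues) : Matrix V V ℝ) ^ N := by
      rw [← diagonal_one, ← diagonal_smul, diagonal_sub, diagonal_pow]
      congr 1
    rw [h1, map_pow, map_sub, map_one, map_smul, ← hS.spectral_theorem]
  rw [h, Unitary.conjStarAlgAut_apply, trace_mul_comm, ← mul_assoc,
    Unitary.coe_star_mul_self, one_mul, trace_diagonal]

/-- Up to sign, the product of the non-zero eigenvalues is the lowest non-zero coefficient of the
characteristic polynomial, so it is a non-zero integer when the matrix is integral. -/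
theorem one_le_prod_eigenvalues (S : Matrix V V ℤ)
    (hS : (S.map (Int.castRingHom ℝ)).PosSemidef) :
    1 ≤ ∏ i with hS.isHermitian.eigenvalues i ≠ 0, hS.isHermitian.eigenvalues i := by
  classical
  set l := hS.isHermitian.eigenvalues with hl
  have hpos : 0 < ∏ i with l i ≠ 0, l i :=
    Finset.prod_pos fun i hi =>
      lt_of_le_of_ne (hS.eigenvalues_nonneg i) (Finset.mem_filter.mp hi).2.symm
  -- The characteristic polynomial is `X^z ∏ (X - l i)`, with `z` the multiplicity of the root zero.
  set z := (Finset.univ.filter fun i => ¬ l i ≠ 0).card with hz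
  have h1 : (S.map (Int.castRingHom ℝ)).charpoly = X ^ z * ∏ i with l i ≠ 0, (X - C (l i)) := by
    rw [hS.isHermitian.charpoly_eq, ← Finset.prod_filter_mul_prod_filter_not _ (fun i => l i ≠ 0),
      mul_comm]
    congr 1
    rw [hz, ← Finset.prod_const]
    refine Finset.prod_congr rfl fun i hi => ?_
    have : l i = 0 := by simpa using hi
    simp [← hl, this]
  have h2 : ((S.charpoly.coeff z : ℤ) : ℝ) = ∏ i with l i ≠ 0, (-l i) := by
    have h3 : (S.map (Int.castRingHom ℝ)).charpoly.coeff z = ((S.charpoly.coeff z : ℤ) : ℝ) := by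
      rw [Matrix.charpoly_map, coeff_map]; rfl
    rw [← h3, h1, coeff_X_pow_mul', if_pos le_rfl, Nat.sub_self, coeff_zero_eq_eval_zero,
      eval_prod]
    simp
  have h4 : |((S.charpoly.coeff z : ℤ) : ℝ)| = ∏ i with l i ≠ 0, l i := by
    rw [h2, Finset.abs_prod]
    exact Finset.prod_congr rfl fun i _ => by rw [abs_neg, abs_of_nonneg (hS.eigenvalues_nonneg i)]
  rw [← h4]
  have h5 : S.charpoly.coeff z ≠ 0 := by
    intro h; rw [h] at h4; simp at h4; linarith
  exact_mod_cast Int.one_le_abs h5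

/-- The elementary estimate behind the logarithmic bound on small eigenvalues: the first term is at
least `1` for `t ≤ ε`, and the second one dominates for `t ≥ ε`. -/
theorem one_sub_pow_le {t ε : ℝ} (ht : 0 < t) (ht1 : t ≤ 1) (hε : 0 < ε) (hε1 : ε < 1) (N : ℕ) :
    (1 - t) ^ N ≤ -Real.log t / Real.log (1 / ε) + (1 - ε) ^ N := by
  have hlog : 0 < Real.log (1 / ε) := Real.log_pos (by rw [lt_div_iff₀ hε]; linarith)
  rcases le_total t ε with h | h
  · have h1 : 1 ≤ -Real.log t / Real.log (1 / ε) := by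
      rw [le_div_iff₀ hlog, one_mul, one_div, Real.log_inv]
      have := Real.log_le_log ht h
      linarith
    have h2 : (1 - t) ^ N ≤ 1 := pow_le_one₀ (by linarith) (by linarith)
    have h3 : 0 ≤ (1 - ε) ^ N := pow_nonneg (by linarith) _
    linarith
  · have h1 : (1 - t) ^ N ≤ (1 - ε) ^ N := pow_le_pow_left₀ (by linarith) (by linarith) _
    have h2 : 0 ≤ -Real.log t / Real.log (1 / ε) :=
      div_nonneg (by linarith [Real.log_nonpos ht.le ht1]) hlog.le
    linarith

/-- The logarithmic bound for the part of the spectrum of an integral Gram matrix near, but not at,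
zero: the eigenvalue zero contributes the same to both traces. The right hand side does not depend
on `j`. -/
theorem trace_pow_sub_trace_pow_le (A : Matrix V V ℤ) {M : ℝ} (hM : 1 ≤ M)
    (hA : ‖A.map (Int.castRingHom ℝ)‖ ^ 2 ≤ M) {ε : ℝ} (hε : 0 < ε) (hε1 : ε < 1) (N j : ℕ) :
    ((1 - M⁻¹ • (Aᵀ * A).map (Int.castRingHom ℝ)) ^ N).trace -
      ((1 - M⁻¹ • (Aᵀ * A).map (Int.castRingHom ℝ)) ^ j).trace ≤
      Fintype.card V * (Real.log M / Real.log (1 / ε) + (1 - ε) ^ N) := by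
  have hM0 : 0 < M := by linarith
  have hSA : (Aᵀ * A).map (Int.castRingHom ℝ) =
      (A.map (Int.castRingHom ℝ))ᴴ * A.map (Int.castRingHom ℝ) := by
    rw [Matrix.map_mul, conjTranspose_eq_transpose_of_trivial, transpose_map]
  have hS : ((Aᵀ * A).map (Int.castRingHom ℝ)).PosSemidef := by
    rw [hSA]; exact posSemidef_conjTranspose_mul_self _
  have hprod := one_le_prod_eigenvalues (Aᵀ * A) hS
  rw [trace_one_sub_smul_pow hS.isHermitian, trace_one_sub_smul_pow hS.isHermitian]
  set l := hS.isHermitian.eigenvalues with hl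
  have h0 : ∀ i, 0 ≤ l i := hS.eigenvalues_nonneg
  have h1 : ∀ i, l i ≤ M := fun i => by
    have : Nonempty V := ⟨i⟩
    have h := spectrum.norm_le_norm_of_mem (hS.isHermitian.eigenvalues_mem_spectrum_real i)
    have e : ‖(Aᵀ * A).map (Int.castRingHom ℝ)‖ = ‖A.map (Int.castRingHom ℝ)‖ ^ 2 := by
      rw [hSA, l2_opNorm_conjTranspose_mul_self, sq]
    exact ((le_abs_self _).trans h).trans (e.trans_le hA)
  have hlog : 0 < Real.log (1 / ε) := Real.log_pos (by rw [lt_div_iff₀ hε]; linarith)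
  have hlogM : 0 ≤ Real.log M := Real.log_nonneg hM
  have hεN : 0 ≤ (1 - ε) ^ N := pow_nonneg (by linarith) _
  have key : ∀ i, (1 - M⁻¹ * l i) ^ N - (1 - M⁻¹ * l i) ^ j ≤
      if l i ≠ 0 then (Real.log M - Real.log (l i)) / Real.log (1 / ε) + (1 - ε) ^ N else 0 := by
    intro i
    split_ifs with h
    · have hpos : 0 < l i := lt_of_le_of_ne (h0 i) h.symm
      have ht : 0 < M⁻¹ * l i := by positivity
      have ht1 : M⁻¹ * l i ≤ 1 := by rw [inv_mul_le_one₀ hM0]; exact h1 i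
      have e := one_sub_pow_le ht ht1 hε hε1 N
      have e2 : -Real.log (M⁻¹ * l i) = Real.log M - Real.log (l i) := by
        rw [Real.log_mul (by positivity) h, Real.log_inv]; ring
      rw [e2] at e
      have : 0 ≤ (1 - M⁻¹ * l i) ^ j := pow_nonneg (by linarith) _
      linarith
    · rw [not_not.mp h]; simp
  rw [← Finset.sum_sub_distrib]
  refine (Finset.sum_le_sum fun i _ => key i).trans ?_
  rw [← Finset.sum_filter, Finset.sum_add_distrib, ← Finset.sum_div, Finset.sum_sub_distrib,
    Finset.sum_const, Finset.sum_const, nsmul_eq_mul, nsmul_eq_mul,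
    ← Real.log_prod (fun i hi => (Finset.mem_filter.mp hi).2)]
  have hcard : (((Finset.univ.filter fun i => l i ≠ 0).card : ℕ) : ℝ) ≤ Fintype.card V := by
    exact_mod_cast Finset.card_le_univ _
  have hl0 : 0 ≤ Real.log (∏ i with l i ≠ 0, l i) := Real.log_nonneg hprod
  rw [mul_add]
  refine add_le_add ?_ (mul_le_mul_of_nonneg_right hcard hεN)
  rw [← mul_div_assoc]
  refine div_le_div_of_nonneg_right ?_ hlog.le
  have := mul_le_mul_of_nonneg_right hcard hlogM
  linarith

end IntegerMatrices

/-! ### Matrices of words in labelled graphs -/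

section GraphMatrices
open Matrix
open scoped Matrix.Norms.L2Operator
variable {r : ℕ} {V : Type*}

open Classical in
/-- The adjacency matrix of the edges with label `x`. -/
def LabelledGraph.stepMatrix (K : LabelledGraph (Fin r × Bool) V) (x : Fin r × Bool) :
    Matrix V V ℤ :=
  Matrix.of fun v w => if K.edge x v w then 1 else 0

theorem LabelledGraph.stepMatrix_eq [DecidableEq V] {K : LabelledGraph (Fin r × Bool) V}
    (hK : K.IsAdmissible) {x : Fin r × Bool} {v w : V} (h : K.edge x v w) (w' : V) :
    K.stepMatrix x v w' = if w' = w then 1 else 0 := by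
  classical
  rw [stepMatrix, Matrix.of_apply]
  refine if_congr ⟨fun h' => hK.1 x v w' w h' h, ?_⟩ rfl rfl
  rintro rfl
  exact h

variable [Fintype V] [DecidableEq V]

/-- The matrix whose entry at `(v, w)` counts the paths from `v` to `w` labelled by a word. -/
def LabelledGraph.wordMatrix (K : LabelledGraph (Fin r × Bool) V) :
    FreeMonoid (Fin r × Bool) →* Matrix V V ℤ :=
  FreeMonoid.lift K.stepMatrix

/-- Every row of a word matrix is zero or a standard basis vector. -/
theorem LabelledGraph.wordMatrix_row {K : LabelledGraph (Fin r × Bool) V} (hK : K.IsAdmissible)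
    (u : FreeMonoid (Fin r × Bool)) (v : V) :
    (∀ w, K.wordMatrix u v w = 0) ∨ ∃ w₀, ∀ w, K.wordMatrix u v w = if w = w₀ then 1 else 0 := by
  classical
  induction u using FreeMonoid.inductionOn' generalizing v with
  | one => exact .inr ⟨v, fun w => by rw [map_one, Matrix.one_apply]; simp [eq_comm]⟩
  | of_mul x u ih =>
    have e (w : V) : K.wordMatrix (FreeMonoid.of x * u) v w =
        ∑ w', K.stepMatrix x v w' * K.wordMatrix u w' w := by
      rw [map_mul, Matrix.mul_apply]
      simp [wordMatrix]
    by_cases h : ∃ w₁, K.edge x v w₁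
    · obtain ⟨w₁, h⟩ := h
      have e' (w : V) : K.wordMatrix (FreeMonoid.of x * u) v w = K.wordMatrix u w₁ w := by
        rw [e]
        simp [stepMatrix_eq hK h]
      simp only [e']
      exact ih w₁
    · refine .inl fun w => ?_
      rw [e]
      refine Finset.sum_eq_zero fun w' _ => ?_
      have : K.stepMatrix x v w' = 0 := by
        rw [stepMatrix, Matrix.of_apply, if_neg fun h' => h ⟨w', h'⟩]
      rw [this, zero_mul]

/-- The formal inverse of a word. -/
def wordInv (u : FreeMonoid (Fin r × Bool)) : FreeMonoid (Fin r × Bool) :=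
  FreeMonoid.reverse (FreeMonoid.map (fun x => (x.1, !x.2)) u)

theorem wordInv_mul (u v : FreeMonoid (Fin r × Bool)) :
    wordInv (u * v) = wordInv v * wordInv u := by
  simp [wordInv, FreeMonoid.reverse_mul]

theorem LabelledGraph.wordMatrix_wordInv {K : LabelledGraph (Fin r × Bool) V}
    (hK : K.IsAdmissible) (u : FreeMonoid (Fin r × Bool)) :
    K.wordMatrix (wordInv u) = (K.wordMatrix u)ᵀ := by
  classical
  induction u using FreeMonoid.inductionOn' with
  | one =>
    have : wordInv (1 : FreeMonoid (Fin r × Bool)) = 1 := rfl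
    rw [this, map_one, Matrix.transpose_one]
  | of_mul x u ih =>
    rw [wordInv_mul, map_mul, ih, map_mul, Matrix.transpose_mul]
    congr 1
    have : wordInv (FreeMonoid.of x) = FreeMonoid.of (x.1, !x.2) := rfl
    rw [this]
    ext v w
    simp only [wordMatrix, FreeMonoid.lift_eval_of, stepMatrix, Matrix.of_apply,
      Matrix.transpose_apply]
    exact if_congr (by simpa using hK.2.2 x.1 (!x.2) v w) rfl rfl

theorem LabelledGraph.norm_wordMatrix_le {K : LabelledGraph (Fin r × Bool) V}
    (hK : K.IsAdmissible) (u : FreeMonoid (Fin r × Bool)) :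
    ‖(K.wordMatrix u).map (Int.castRingHom ℝ)‖ ≤ 1 := by
  classical
  have hstep (x : Fin r × Bool) : ‖(K.stepMatrix x).map (Int.castRingHom ℝ)‖ ≤ 1 := by
    -- `PᵀP` is diagonal with entries `0` and `1`, since labels are unique at in-edges.
    have h : ((K.stepMatrix x).map (Int.castRingHom ℝ))ᴴ * (K.stepMatrix x).map (Int.castRingHom ℝ)
        = diagonal fun w => if ∃ v, K.edge x v w then (1 : ℝ) else 0 := by
      ext w w'
      rw [Matrix.mul_apply, Matrix.diagonal_apply]
      simp only [Matrix.conjTranspose_apply, Matrix.map_apply, stepMatrix, Matrix.of_apply,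
        star_trivial, eq_intCast, Int.cast_ite, Int.cast_one, Int.cast_zero, mul_ite, mul_one,
        mul_zero]
      simp only [← ite_and (K.edge x _ w')]
      split_ifs with hw hv
      · subst hw
        obtain ⟨v, hv⟩ := hv
        rw [Finset.sum_eq_single v]
        · simp [hv]
        · intro v' _ hne
          rw [if_neg fun hc => hne (hK.2.1 x v' v w hc.1 hv)]
        · simp
      · subst hw
        exact Finset.sum_eq_zero fun v _ => if_neg fun hc => hv ⟨v, hc.1⟩
      · exact Finset.sum_eq_zero fun v _ => if_neg fun hc => hw (hK.1 x v w w' hc.2 hc.1)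
    have h2 : ‖(K.stepMatrix x).map (Int.castRingHom ℝ)‖ *
        ‖(K.stepMatrix x).map (Int.castRingHom ℝ)‖ ≤ 1 := by
      rw [← l2_opNorm_conjTranspose_mul_self, h, l2_opNorm_diagonal]
      refine (pi_norm_le_iff_of_nonneg zero_le_one).mpr fun w => ?_
      split_ifs <;> simp
    nlinarith [norm_nonneg ((K.stepMatrix x).map (Int.castRingHom ℝ))]
  induction u using FreeMonoid.inductionOn' with
  | one =>
    rw [map_one, Matrix.map_one _ (map_zero _) (map_one _), ← diagonal_one, l2_opNorm_diagonal]
    exact (pi_norm_le_iff_of_nonneg zero_le_one).mpr fun w => by simp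
  | of_mul x u ih =>
    rw [map_mul, Matrix.map_mul]
    refine (l2_opNorm_mul _ _).trans (mul_le_one₀ ?_ (norm_nonneg _) ih)
    simpa [wordMatrix] using hstep x

end GraphMatrices

/-! ### Words at vertices of sofic approximations -/

section Balls
variable {G : Type u} [Group G] {r : ℕ}

/-- The evaluation of words in a group. -/
def wordEval (h : Fin r → G) : FreeMonoid (Fin r × Bool) →* G := FreeMonoid.lift (letter h)

theorem letter_not (h : Fin r → G) (x : Fin r × Bool) :
    letter h (x.1, !x.2) = (letter h x)⁻¹ := by
  rcases x with ⟨i, _ | _⟩ <;> simp [letter]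

theorem wordEval_wordInv (h : Fin r → G) (u : FreeMonoid (Fin r × Bool)) :
    wordEval h (wordInv u) = (wordEval h u)⁻¹ := by
  induction u using FreeMonoid.inductionOn' with
  | one => rw [map_one, inv_one]; exact map_one _
  | of_mul x u ih =>
    rw [wordInv_mul, map_mul, ih, map_mul, mul_inv_rev]
    congr 1
    exact letter_not h x

theorem wordEval_surjective {h : Fin r → G} (hgen : Subgroup.closure (Set.range h) = ⊤) :
    Function.Surjective (wordEval h) := by
  intro x
  have hx : x ∈ Subgroup.closure (Set.range h) := hgen ▸ Subgroup.mem_top x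
  induction hx using Subgroup.closure_induction with
  | mem x hx =>
    obtain ⟨i, rfl⟩ := hx
    exact ⟨FreeMonoid.of (i, true), by simp [wordEval, letter]⟩
  | one => exact ⟨1, map_one _⟩
  | mul x y _ _ hx hy =>
    obtain ⟨u, rfl⟩ := hx
    obtain ⟨v, rfl⟩ := hy
    exact ⟨u * v, map_mul _ _ _⟩
  | inv x _ hx =>
    obtain ⟨u, rfl⟩ := hx
    exact ⟨wordInv u, wordEval_wordInv h u⟩

theorem LabelledGraph.ball_mono {L V : Type*} (K : LabelledGraph L V) (v : V) {R R' : ℕ}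
    (h : R ≤ R') : K.ball v R ⊆ K.ball v R' := by
  induction h with
  | refl => exact subset_rfl
  | step _ ih => exact ih.trans Set.subset_union_left

theorem wordEval_mem_ball (h : Fin r → G) (u : List (Fin r × Bool)) :
    wordEval h (FreeMonoid.ofList u) ∈ (cayleyDiagram h).ball 1 u.length := by
  induction u using List.reverseRecOn with
  | nil => rfl
  | append_singleton u x ih =>
    rw [List.length_append, List.length_singleton, FreeMonoid.ofList_append, map_mul]
    exact Or.inr ⟨_, ih, x, Or.inl (by simp [cayleyDiagram, wordEval])⟩

/-- At a vertex whose ball looks like the Cayley diagram, a short word leads to the vertex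
corresponding to its value in the group. -/
theorem wordMatrix_apply_of_ballsIso {V : Type*} [Fintype V] [DecidableEq V] {h : Fin r → G}
    {K : LabelledGraph (Fin r × Bool) V}
    (hK : K.IsAdmissible) {v : V} {R : ℕ} {φ : G → V} (h1 : φ 1 = v)
    (hedge : ∀ a ∈ (cayleyDiagram h).ball 1 R, ∀ b ∈ (cayleyDiagram h).ball 1 R, ∀ l,
      (cayleyDiagram h).edge l a b ↔ K.edge l (φ a) (φ b))
    (u : List (Fin r × Bool)) (hu : u.length ≤ R) (w : V) :
    K.wordMatrix (FreeMonoid.ofList u) v w =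
      if w = φ (wordEval h (FreeMonoid.ofList u)) then 1 else 0 := by
  induction u using List.reverseRecOn generalizing w with
  | nil =>
    rw [FreeMonoid.ofList_nil, map_one, map_one, h1, Matrix.one_apply]
    simp [eq_comm]
  | append_singleton u x ih =>
    have hlen : u.length + 1 ≤ R := by simpa using hu
    have ha := (cayleyDiagram h).ball_mono 1 (by omega : u.length ≤ R) (wordEval_mem_ball h u)
    have hb := (cayleyDiagram h).ball_mono 1 hu (wordEval_mem_ball h (u ++ [x]))
    have hab : (cayleyDiagram h).edge x (wordEval h (FreeMonoid.ofList u))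
        (wordEval h (FreeMonoid.ofList (u ++ [x]))) := by
      simp [cayleyDiagram, wordEval, FreeMonoid.ofList_append]
    have he := (hedge _ ha _ hb x).mp hab
    rw [← LabelledGraph.stepMatrix_eq hK he, FreeMonoid.ofList_append, map_mul, Matrix.mul_apply]
    simp only [ih (by omega), ite_mul, one_mul, zero_mul, Finset.sum_ite_eq', Finset.mem_univ,
      if_true]
    simp [LabelledGraph.wordMatrix]

open Classical in
/-- The normalized trace of a short word matrix is close to the trace of the word in the group. -/
theorem abs_trace_wordMatrix_sub_le {V : Type*} [Fintype V] [DecidableEq V] {h : Fin r → G}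
    {K : LabelledGraph (Fin r × Bool) V} (hK : K.IsAdmissible) {R : ℕ} {ε : ℝ}
    (hε : (1 - ε) * (Fintype.card V : ℝ) ≤
      (Set.ncard {v | (cayleyDiagram h).BallsIso 1 K v R} : ℝ))
    (u : FreeMonoid (Fin r × Bool)) (hu : u.length ≤ R) :
    |((K.wordMatrix u).trace : ℝ) - Fintype.card V * (if wordEval h u = 1 then 1 else 0)| ≤
      ε * Fintype.card V := by
  set s : Finset V := Finset.univ.filter fun v => (cayleyDiagram h).BallsIso 1 K v R with hs
  have hcard : (Set.ncard {v | (cayleyDiagram h).BallsIso 1 K v R} : ℝ) = s.card := by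
    rw [← Set.ncard_coe_finset]; simp [hs]
  have hbad : ((sᶜ).card : ℝ) ≤ ε * Fintype.card V := by
    rw [Finset.card_compl, Nat.cast_sub (Finset.card_le_univ _)]
    rw [hcard] at hε
    linarith
  refine le_trans ?_ hbad
  have e : ((K.wordMatrix u).trace : ℝ) - Fintype.card V * (if wordEval h u = 1 then 1 else 0) =
      ∑ v, (((K.wordMatrix u v v : ℤ) : ℝ) - if wordEval h u = 1 then 1 else 0) := by
    rw [Finset.sum_sub_distrib, Finset.sum_const, Finset.card_univ, nsmul_eq_mul, Matrix.trace]
    push_cast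
    rfl
  rw [e]
  refine (Finset.abs_sum_le_sum_abs _ _).trans ?_
  have hterm (v : V) : |(((K.wordMatrix u v v : ℤ) : ℝ) - if wordEval h u = 1 then 1 else 0)| ≤
      if v ∈ sᶜ then 1 else 0 := by
    by_cases hv : v ∈ s
    · have hc : (if v ∈ sᶜ then (1 : ℝ) else 0) = 0 := if_neg (by simpa using hv)
      rw [hc]
      obtain ⟨φ, h1, hbij, hedge⟩ := (Finset.mem_filter.mp hv).2
      have h2 := wordMatrix_apply_of_ballsIso hK h1 hedge u.toList hu v
      rw [FreeMonoid.ofList_toList] at h2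
      have h3 : v = φ (wordEval h u) ↔ wordEval h u = 1 := by
        rw [← h1]
        have hm1 : (1 : G) ∈ (cayleyDiagram h).ball 1 R :=
          (cayleyDiagram h).ball_mono 1 (Nat.zero_le R) rfl
        have hmu : wordEval h u ∈ (cayleyDiagram h).ball 1 R :=
          (cayleyDiagram h).ball_mono 1 hu (wordEval_mem_ball h u.toList)
        exact ⟨fun he => (hbij.injOn hm1 hmu he).symm, fun he => by rw [he]⟩
      rw [h2]
      simp only [h3]
      split_ifs <;> simp
    · have hc : (if v ∈ sᶜ then (1 : ℝ) else 0) = 1 := if_pos (by simpa using hv)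
      rw [hc]
      rcases LabelledGraph.wordMatrix_row hK u v with h0 | ⟨w₀, h0⟩ <;> rw [h0 v] <;>
        split_ifs <;> simp
  refine (Finset.sum_le_sum fun v _ => hterm v).trans ?_
  rw [Finset.sum_boole, Finset.filter_univ_mem]

end Balls

/-! ### The normalized trace -/

section Normalization
variable {G : Type u}

theorem inv_smul_natCast {𝕜 R : Type*} [Field 𝕜] [Ring R] [Module 𝕜 R] {M : ℕ}
    (hM : (M : 𝕜) ≠ 0) : (M : 𝕜)⁻¹ • (M : R) = 1 := by
  have h : (M : R) = (M : 𝕜) • (1 : R) := by rw [Nat.cast_smul_eq_nsmul, nsmul_one]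
  rw [h, smul_smul, inv_mul_cancel₀ hM, one_smul]

/-- The positive integer by which `a* a` is divided. For `a ≠ 0` it is `|a|²`; for `a = 0` it is
`1`, which gives the same operator `0` without dividing by zero. -/
def normSq (a : MonoidAlgebra ℤ G) : ℕ := max (coeffNorm a ^ 2) 1

theorem one_le_normSq (a : MonoidAlgebra ℤ G) : 1 ≤ normSq a := le_max_right _ _

theorem normSq_ne_zero (a : MonoidAlgebra ℤ G) : (normSq a : ℂ) ≠ 0 := by
  have := one_le_normSq a
  exact_mod_cast (by omega : normSq a ≠ 0)

theorem coeffNorm_eq_zero {a : MonoidAlgebra ℤ G} : coeffNorm a = 0 ↔ a = 0 := by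
  constructor
  · intro h
    rw [coeffNorm, Finsupp.sum, Finset.sum_eq_zero_iff] at h
    ext g
    by_contra hg
    exact hg (by simpa using h g (Finsupp.mem_support_iff.mpr hg))
  · rintro rfl; simp [coeffNorm]

theorem normSq_eq {a : MonoidAlgebra ℤ G} (ha : a ≠ 0) : normSq a = coeffNorm a ^ 2 :=
  max_eq_left (Nat.one_le_pow _ _ (Nat.pos_of_ne_zero (coeffNorm_eq_zero.not.mpr ha)))

variable [Group G]

/-- The integral group ring element `(M - a* a)^N`, where `M = normSq a`. -/
def complementPow (a : MonoidAlgebra ℤ G) (N : ℕ) : MonoidAlgebra ℤ G :=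
  ((normSq a : MonoidAlgebra ℤ G) - involution a * a) ^ N

theorem normalizedSquare_eq (a : MonoidAlgebra ℤ G) :
    normalizedSquare a = (normSq a : ℂ)⁻¹ • (star (intOp a) * intOp a) := by
  by_cases ha : a = 0
  · subst ha
    have : intOp (0 : MonoidAlgebra ℤ G) = 0 := map_zero intOpHom
    simp [normalizedSquare, this]
  · rw [normalizedSquare, normSq_eq ha]
    push_cast
    rfl

theorem one_sub_normalizedSquare_pow (a : MonoidAlgebra ℤ G) (N : ℕ) :
    (1 - normalizedSquare a) ^ N = ((normSq a : ℂ) ^ N)⁻¹ • intOp (complementPow a N) := by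
  have h : 1 - normalizedSquare a = (normSq a : ℂ)⁻¹ •
      intOpHom ((normSq a : MonoidAlgebra ℤ G) - involution a * a) := by
    rw [map_sub, map_mul, map_natCast, intOpHom_apply, intOpHom_apply, ← star_intOp, smul_sub,
      normalizedSquare_eq]
    rw [inv_smul_natCast (normSq_ne_zero a)]
  rw [h, smul_pow, ← map_pow, inv_pow]
  rfl

/-- The trace of `(1 - T)^N` is a rational number with numerator a coefficient of an element of the
integral group ring. -/
theorem vnTrace_one_sub_pow (a : MonoidAlgebra ℤ G) (N : ℕ) :
    vnTrace ((1 - normalizedSquare a) ^ N) =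
      ((complementPow a N).coeff 1 : ℂ) / (normSq a : ℂ) ^ N := by
  rw [one_sub_normalizedSquare_pow, vnTrace, _root_.smul_apply,
    inner_smul_right]
  have := vnTrace_intOp (complementPow a N)
  rw [vnTrace] at this
  rw [this, div_eq_inv_mul]

/-- The trace of `(1 - T)^N`, as a real number. -/
def complementTrace (a : MonoidAlgebra ℤ G) (N : ℕ) : ℝ :=
  ((complementPow a N).coeff 1 : ℝ) / (normSq a : ℝ) ^ N

theorem vnTrace_eq_complementTrace (a : MonoidAlgebra ℤ G) (N : ℕ) :
    vnTrace ((1 - normalizedSquare a) ^ N) = (complementTrace a N : ℂ) := by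
  rw [vnTrace_one_sub_pow, complementTrace]
  push_cast
  rfl

theorem normalizedSquare_nonneg (a : MonoidAlgebra ℤ G) : 0 ≤ normalizedSquare a := by
  rw [normalizedSquare_eq]
  have h : (0 : L2 G →L[ℂ] L2 G) ≤ star (intOp a) * intOp a := star_mul_self_nonneg _
  rw [ContinuousLinearMap.nonneg_iff_isPositive] at h ⊢
  refine h.smul_of_nonneg ?_
  rw [← Complex.ofReal_natCast, ← Complex.ofReal_inv, Complex.zero_le_real]
  positivity

theorem norm_star_mul_intOp_le (a : MonoidAlgebra ℤ G) :
    ‖star (intOp a) * intOp a‖ ≤ normSq a := by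
  refine (CStarRing.norm_star_mul_self (x := intOp a)).le.trans ?_
  rw [← sq]
  refine (pow_le_pow_left₀ (norm_nonneg _) (norm_intOp_le a) 2).trans ?_
  exact_mod_cast le_max_left _ _

theorem normalizedSquare_le_one (a : MonoidAlgebra ℤ G) : normalizedSquare a ≤ 1 := by
  rw [← CStarAlgebra.norm_le_one_iff_of_nonneg _ (normalizedSquare_nonneg a), normalizedSquare_eq,
    norm_smul, norm_inv, Complex.norm_natCast, inv_mul_le_one₀ (by exact_mod_cast one_le_normSq a)]
  exact norm_star_mul_intOp_le a

theorem norm_one_sub_normalizedSquare_le (a : MonoidAlgebra ℤ G) :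
    ‖1 - normalizedSquare a‖ ≤ 1 := by
  rw [CStarAlgebra.norm_le_one_iff_of_nonneg _ (sub_nonneg.mpr (normalizedSquare_le_one a))]
  exact sub_le_self _ (normalizedSquare_nonneg a)

theorem normalizedSquare_apply_eq_zero_iff (a : MonoidAlgebra ℤ G) (v : L2 G) :
    normalizedSquare a v = 0 ↔ intOp a v = 0 := by
  rw [normalizedSquare_eq, _root_.smul_apply,
    smul_eq_zero_iff_right (inv_ne_zero (normSq_ne_zero a))]
  constructor
  · intro h
    rw [← inner_self_eq_zero (𝕜 := ℂ), ← ContinuousLinearMap.adjoint_inner_right,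
      ← ContinuousLinearMap.star_eq_adjoint]
    change ⟪v, (star (intOp a) * intOp a) v⟫_ℂ = 0
    rw [h, inner_zero_right]
  · intro h
    change star (intOp a) (intOp a v) = 0
    rw [h, map_zero]

theorem complementTrace_nonneg (a : MonoidAlgebra ℤ G) (N : ℕ) : 0 ≤ complementTrace a N := by
  have h0 : 0 ≤ (1 - normalizedSquare a) ^ N :=
    CStarAlgebra.pow_nonneg (sub_nonneg.mpr (normalizedSquare_le_one a)) N
  have h1 := ((ContinuousLinearMap.nonneg_iff_isPositive _).mp h0).re_inner_nonneg_right
    (zeta (1 : G))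
  have h2 := vnTrace_eq_complementTrace a N
  rw [vnTrace] at h2
  rw [h2] at h1
  simpa using h1

end Normalization

/-! ### Traces along sofic approximations -/

section Sofic
open Matrix
open scoped Matrix.Norms.L2Operator
variable {G : Type u} [Group G] {r : ℕ}

/-- The extension of `wordMatrix` to integral combinations of words. -/
def LabelledGraph.matrixHom {V : Type*} [Fintype V] [DecidableEq V]
    (K : LabelledGraph (Fin r × Bool) V) :
    MonoidAlgebra ℤ (FreeMonoid (Fin r × Bool)) →ₐ[ℤ] Matrix V V ℤ :=
  MonoidAlgebra.lift ℤ (Matrix V V ℤ) (FreeMonoid (Fin r × Bool)) K.wordMatrix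

/-- The extension of `wordEval` to integral combinations of words. -/
def evalHom (h : Fin r → G) :
    MonoidAlgebra ℤ (FreeMonoid (Fin r × Bool)) →ₐ[ℤ] MonoidAlgebra ℤ G :=
  MonoidAlgebra.lift ℤ (MonoidAlgebra ℤ G) (FreeMonoid (Fin r × Bool))
    ((MonoidAlgebra.of ℤ G).comp (wordEval h))

theorem LabelledGraph.matrixHom_single {V : Type*} [Fintype V] [DecidableEq V]
    (K : LabelledGraph (Fin r × Bool) V) (u : FreeMonoid (Fin r × Bool)) (c : ℤ) :
    K.matrixHom (MonoidAlgebra.single u c) = c • K.wordMatrix u := by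
  simp [matrixHom]

theorem evalHom_single (h : Fin r → G) (u : FreeMonoid (Fin r × Bool)) (c : ℤ) :
    evalHom h (MonoidAlgebra.single u c) = MonoidAlgebra.single (wordEval h u) c := by
  simp [evalHom]

/-- Normalized traces along sofic approximations converge to the trace of the group ring: for an
`(ε, R)`-approximation with `R` large enough, the error is at most `C ε`. -/
theorem exists_abs_trace_matrixHom_sub_le (h : Fin r → G)
    (b : MonoidAlgebra ℤ (FreeMonoid (Fin r × Bool))) :
    ∃ (R₀ : ℕ) (C : ℝ), 0 ≤ C ∧ ∀ (ε : ℝ) (R : ℕ), R₀ ≤ R → ∀ (N : ℕ)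
      (K : LabelledGraph (Fin r × Bool) (Fin N)), K.IsAdmissible →
      (1 - ε) * (N : ℝ) ≤ (Set.ncard {v | (cayleyDiagram h).BallsIso 1 K v R} : ℝ) →
      |((K.matrixHom b).trace : ℝ) - N * ((evalHom h b).coeff 1 : ℝ)| ≤ C * (ε * N) := by
  classical
  refine ⟨b.coeff.support.sup FreeMonoid.length, ∑ u ∈ b.coeff.support, |(b.coeff u : ℝ)|,
    Finset.sum_nonneg fun _ _ => abs_nonneg _, fun ε R hR N K hK hε => ?_⟩
  have hb : b = ∑ u ∈ b.coeff.support, MonoidAlgebra.single u (b.coeff u) :=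
    (MonoidAlgebra.sum_coeff_single b).symm
  have h1 : ((K.matrixHom b).trace : ℝ) =
      ∑ u ∈ b.coeff.support, (b.coeff u : ℝ) * ((K.wordMatrix u).trace : ℝ) := by
    conv_lhs => rw [hb]
    rw [map_sum, Matrix.trace_sum]
    simp only [LabelledGraph.matrixHom_single, Matrix.trace_smul, smul_eq_mul]
    push_cast
    rfl
  have h2 : ((evalHom h b).coeff 1 : ℝ) =
      ∑ u ∈ b.coeff.support, (b.coeff u : ℝ) * (if wordEval h u = 1 then 1 else 0) := by
    conv_lhs => rw [hb]
    rw [map_sum, MonoidAlgebra.coeff_sum, Finsupp.finsetSum_apply]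
    simp only [evalHom_single, MonoidAlgebra.coeff_single, Finsupp.single_apply]
    push_cast
    simp
  rw [h1, h2, Finset.mul_sum, ← Finset.sum_sub_distrib, Finset.sum_mul]
  refine (Finset.abs_sum_le_sum_abs _ _).trans (Finset.sum_le_sum fun u hu => ?_)
  have h3 := abs_trace_wordMatrix_sub_le (h := h) hK (R := R) (ε := ε)
    (by rw [Fintype.card_fin]; exact hε) u ((Finset.le_sup hu).trans hR)
  rw [Fintype.card_fin] at h3
  have h4 : (b.coeff u : ℝ) * ((K.wordMatrix u).trace : ℝ) -
      N * ((b.coeff u : ℝ) * (if wordEval h u = 1 then 1 else 0)) =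
      (b.coeff u : ℝ) * (((K.wordMatrix u).trace : ℝ) -
        N * (if wordEval h u = 1 then 1 else 0)) := by ring
  rw [h4, abs_mul]
  exact mul_le_mul_of_nonneg_left h3 (abs_nonneg _)

/-- The spectral estimate for finite integral matrices passes to the group ring of a sofic
group. -/
theorem complementTrace_sub_le {h : Fin r → G} (hgen : Subgroup.closure (Set.range h) = ⊤)
    (hs : HasSoficApproximations h) (a : MonoidAlgebra ℤ G) {ε : ℝ} (hε : 0 < ε) (hε1 : ε < 1)
    (N j : ℕ) :
    complementTrace a N - complementTrace a j ≤
      Real.log (normSq a) / Real.log (1 / ε) + (1 - ε) ^ N := by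
  -- Every `x ∈ G` is represented by a single word `σ x`, so that the lift `B` of `a` has the same
  -- coefficients, and its matrices have norm at most `|a|`.
  set σ : G → FreeMonoid (Fin r × Bool) := Function.surjInv (wordEval_surjective hgen) with hσ
  have hσe (x : G) : wordEval h (σ x) = x := Function.surjInv_eq _ x
  set B : MonoidAlgebra ℤ (FreeMonoid (Fin r × Bool)) :=
    ∑ x ∈ a.coeff.support, MonoidAlgebra.single (σ x) (a.coeff x) with hB
  set B' : MonoidAlgebra ℤ (FreeMonoid (Fin r × Bool)) :=
    ∑ x ∈ a.coeff.support, MonoidAlgebra.single (wordInv (σ x)) (a.coeff x) with hB'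
  have heB : evalHom h B = a := by
    rw [hB, map_sum]
    simp only [evalHom_single, hσe]
    exact MonoidAlgebra.sum_coeff_single a
  have heB' : evalHom h B' = involution a := by
    rw [hB', map_sum]
    simp only [evalHom_single, wordEval_wordInv, hσe]
    rfl
  set M : ℕ := normSq a with hM
  have hM1 : (1 : ℝ) ≤ M := by exact_mod_cast one_le_normSq a
  have hM0 : (0 : ℝ) < M := by linarith
  have heval (i : ℕ) : evalHom h (((M : MonoidAlgebra ℤ (FreeMonoid (Fin r × Bool))) - B' * B) ^ i)
      = complementPow a i := by
    rw [map_pow, map_sub, map_mul, map_natCast, heB, heB']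
    rfl
  obtain ⟨R₁, C₁, hC₁, happ₁⟩ := exists_abs_trace_matrixHom_sub_le h
    (((M : MonoidAlgebra ℤ (FreeMonoid (Fin r × Bool))) - B' * B) ^ N)
  obtain ⟨R₂, C₂, hC₂, happ₂⟩ := exists_abs_trace_matrixHom_sub_le h
    (((M : MonoidAlgebra ℤ (FreeMonoid (Fin r × Bool))) - B' * B) ^ j)
  -- One approximation has to serve for both powers; `η` keeps the sum of the two errors below `δ`.
  refine le_of_forall_pos_le_add fun δ hδ => ?_
  set η : ℝ := δ / (C₁ + C₂ + 1) with hη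
  have hη0 : 0 < η := by positivity
  have hηδ : C₁ * η + C₂ * η ≤ δ := by
    have : η * (C₁ + C₂ + 1) = δ := by rw [hη]; field_simp
    nlinarith
  obtain ⟨n, K, hn, hK, hball⟩ := hs η hη0 (max R₁ R₂)
  have e₁ := happ₁ η _ (le_max_left _ _) n K hK hball
  have e₂ := happ₂ η _ (le_max_right _ _) n K hK hball
  rw [heval] at e₁ e₂
  set A := K.matrixHom B with hA
  have hA' : K.matrixHom B' = Aᵀ := by
    rw [hA, hB, hB', map_sum, map_sum, Matrix.transpose_sum]
    simp only [LabelledGraph.matrixHom_single, Matrix.transpose_smul,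
      LabelledGraph.wordMatrix_wordInv hK]
  have hnorm : ‖A.map (Int.castRingHom ℝ)‖ ≤ coeffNorm a := by
    have : A.map (Int.castRingHom ℝ) = ∑ x ∈ a.coeff.support,
        (a.coeff x : ℝ) • (K.wordMatrix (σ x)).map (Int.castRingHom ℝ) := by
      rw [hA, hB, map_sum, ← RingHom.mapMatrix_apply, map_sum]
      refine Finset.sum_congr rfl fun x _ => ?_
      rw [LabelledGraph.matrixHom_single, map_zsmul, ← Int.cast_smul_eq_zsmul ℝ]
      rfl
    rw [this, coeffNorm, Finsupp.sum]
    push_cast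
    refine (norm_sum_le _ _).trans (Finset.sum_le_sum fun x _ => ?_)
    rw [norm_smul]
    have h2 : ‖((a.coeff x : ℤ) : ℝ)‖ = ((a.coeff x).natAbs : ℝ) := by
      rw [Nat.cast_natAbs, Int.cast_abs]; rfl
    rw [h2]
    exact mul_le_of_le_one_right (Nat.cast_nonneg _) (LabelledGraph.norm_wordMatrix_le hK _)
  have hnorm2 : ‖A.map (Int.castRingHom ℝ)‖ ^ 2 ≤ (M : ℝ) := by
    refine (pow_le_pow_left₀ (norm_nonneg _) hnorm 2).trans ?_
    exact_mod_cast le_max_left _ _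
  have key := trace_pow_sub_trace_pow_le A hM1 hnorm2 hε hε1 N j
  rw [Fintype.card_fin] at key
  have htr (i : ℕ) : ((1 - (M : ℝ)⁻¹ • (Aᵀ * A).map (Int.castRingHom ℝ)) ^ i).trace =
      ((K.matrixHom (((M : MonoidAlgebra ℤ (FreeMonoid (Fin r × Bool))) - B' * B) ^ i)).trace : ℝ) /
        (M : ℝ) ^ i := by
    rw [map_pow, map_sub, map_mul, map_natCast, hA', ← hA]
    have e1 : (((((M : Matrix (Fin n) (Fin n) ℤ) - Aᵀ * A) ^ i).trace : ℤ) : ℝ) =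
        ((((M : Matrix (Fin n) (Fin n) ℝ) - (Aᵀ * A).map (Int.castRingHom ℝ)) ^ i).trace) := by
      have := AddMonoidHom.map_trace (Int.castRingHom ℝ)
        (((M : Matrix (Fin n) (Fin n) ℤ) - Aᵀ * A) ^ i)
      refine this.trans ?_
      congr 1
      change (Int.castRingHom ℝ).mapMatrix _ = _
      rw [map_pow, map_sub, map_natCast]
      rfl
    rw [e1]
    have e2 : (1 - (M : ℝ)⁻¹ • (Aᵀ * A).map (Int.castRingHom ℝ)) =
        (M : ℝ)⁻¹ • ((M : Matrix (Fin n) (Fin n) ℝ) - (Aᵀ * A).map (Int.castRingHom ℝ)) := by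
      rw [smul_sub]
      rw [inv_smul_natCast hM0.ne']
    rw [e2, smul_pow, Matrix.trace_smul, smul_eq_mul, inv_pow, div_eq_inv_mul]
  rw [htr, htr] at key
  have hn0 : (0 : ℝ) < n := by exact_mod_cast hn
  have hscale (i : ℕ) (C t : ℝ) (ht : |t - n * ((complementPow a i).coeff 1 : ℝ)| ≤ C * (η * n)) :
      |t / (M : ℝ) ^ i - n * complementTrace a i| ≤ C * (η * n) := by
    have hMi : 1 ≤ (M : ℝ) ^ i := one_le_pow₀ hM1
    have : t / (M : ℝ) ^ i - n * complementTrace a i =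
        (t - n * ((complementPow a i).coeff 1 : ℝ)) / (M : ℝ) ^ i := by
      rw [complementTrace]; ring
    rw [this, abs_div, abs_of_pos (by linarith : (0 : ℝ) < (M : ℝ) ^ i)]
    exact (div_le_self (abs_nonneg _) hMi).trans ht
  have f₁ := abs_le.mp (hscale _ _ _ e₁)
  have f₂ := abs_le.mp (hscale _ _ _ e₂)
  have hfin : (n : ℝ) * (complementTrace a N - complementTrace a j) ≤
      n * (Real.log M / Real.log (1 / ε) + (1 - ε) ^ N + δ) := by
    have := mul_le_mul_of_nonneg_right hηδ hn0.le
    linarith [f₁.1, f₂.2]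
  exact le_of_mul_le_mul_left hfin hn0

end Sofic

/-! ### Trivial kernel: the mean ergodic theorem -/

section Ergodic
open Filter Topology
variable {G : Type u} [Group G]

/-- If `a` has trivial kernel, the Cesàro means of the traces of the powers of `1 - T` tend to
zero, by von Neumann's mean ergodic theorem. -/
theorem tendsto_average_complementTrace {a : MonoidAlgebra ℤ G} (ha : ¬ IsL2ZeroDivisor a) :
    Tendsto (fun n : ℕ => (n : ℝ)⁻¹ * ∑ j ∈ Finset.range n, complementTrace a j) atTop (𝓝 0) := by
  set B : L2 G →L[ℂ] L2 G := 1 - normalizedSquare a with hB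
  have h := B.tendsto_birkhoffAverage_orthogonalProjection (norm_one_sub_normalizedSquare_le a)
    (zeta (1 : G))
  have hP : ((B.eqLocus (1 : L2 G →L[ℂ] L2 G)).orthogonalProjectionOnto (zeta (1 : G)) :
      L2 G) = 0 := by
    set p := (B.eqLocus (1 : L2 G →L[ℂ] L2 G)).orthogonalProjectionOnto (zeta (1 : G))
      with hp
    have h1 : B (p : L2 G) = (p : L2 G) := p.2
    by_contra hne
    refine ha ⟨p, hne, ?_⟩
    rw [← normalizedSquare_apply_eq_zero_iff]
    have h2 : (p : L2 G) - normalizedSquare a p = p := h1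
    exact sub_eq_self.mp h2
  rw [hP] at h
  have h2 : Tendsto (fun n : ℕ => (⟪zeta (1 : G), birkhoffAverage ℂ B id n (zeta 1)⟫_ℂ).re) atTop
      (𝓝 0) := by
    have := (Complex.continuous_re.tendsto _).comp
      ((tendsto_const_nhds (x := zeta (1 : G))).inner (𝕜 := ℂ) h)
    rw [inner_zero_right, Complex.zero_re] at this
    exact this
  refine h2.congr fun n => ?_
  have h3 (j : ℕ) : ⟪zeta (1 : G), (B^[j]) (zeta 1)⟫_ℂ = (complementTrace a j : ℂ) := by
    rw [← vnTrace_eq_complementTrace, vnTrace, ← hB, FunLike.coe_pow_eq_iterate]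
  rw [birkhoffAverage, birkhoffSum, inner_smul_right, inner_sum]
  simp only [id, h3]
  rw [← Complex.ofReal_sum, ← Complex.ofReal_natCast, ← Complex.ofReal_inv, ← Complex.ofReal_mul,
    Complex.ofReal_re]

/-- Averaging `complementTrace_sub_le` over `j` removes the subtracted trace when `a` has trivial
kernel. -/
theorem complementTrace_le {r : ℕ} {h : Fin r → G}
    (hgen : Subgroup.closure (Set.range h) = ⊤) (hs : HasSoficApproximations h)
    {a : MonoidAlgebra ℤ G} (ha : ¬ IsL2ZeroDivisor a) {ε : ℝ} (hε : 0 < ε) (hε1 : ε < 1)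
    (N : ℕ) :
    complementTrace a N ≤ Real.log (normSq a) / Real.log (1 / ε) + (1 - ε) ^ N := by
  set C := Real.log (normSq a) / Real.log (1 / ε) + (1 - ε) ^ N with hC
  have key : complementTrace a N - C ≤ 0 := by
    refine ge_of_tendsto (tendsto_average_complementTrace ha) ?_
    filter_upwards [eventually_ge_atTop 1] with n hn
    have hn0 : (0 : ℝ) < n := by exact_mod_cast hn
    rw [le_inv_mul_iff₀ hn0]
    have := Finset.card_nsmul_le_sum (Finset.range n) (complementTrace a) (complementTrace a N - C)
      fun j _ => by linarith [complementTrace_sub_le hgen hs a hε hε1 N j]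
    simpa using this
  linarith

end Ergodic

/-! ### Non-trivial kernel: the atom at zero -/

section AtiyahBound
open Filter Topology
variable {G : Type u}

/-- The identification of `ℓ²(G)` with `ℓ²(G)^1`. -/
def toL2Pow (v : L2 G) : L2Pow G 1 := WithLp.toLp 2 fun _ => v

theorem toL2Pow_surjective (x : L2Pow G 1) : ∃ v : L2 G, x = toL2Pow v :=
  ⟨x 0, by ext i; fin_cases i; rfl⟩

theorem inner_toL2Pow (u v : L2 G) : ⟪toL2Pow u, toL2Pow v⟫_ℂ = ⟪u, v⟫_ℂ := by
  simp [PiLp.inner_apply, toL2Pow]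

theorem norm_toL2Pow (v : L2 G) : ‖toL2Pow v‖ = ‖v‖ := by
  simp [PiLp.norm_eq_of_L2, toL2Pow]

variable [Group G]

theorem ratOp_map (a : MonoidAlgebra ℤ G) :
    ratOp (MonoidAlgebra.mapRingHom G (Int.castRingHom ℚ) a) = intOp a := by
  rw [ratOp, intOp]
  congr 1
  ext g
  simp

/-- The `1 × 1` matrix `a* a` over the rational group ring. -/
def gramMatrix (a : MonoidAlgebra ℤ G) : Matrix (Fin 1) (Fin 1) (MonoidAlgebra ℚ G) :=
  fun _ _ => MonoidAlgebra.mapRingHom G (Int.castRingHom ℚ) (involution a * a)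

theorem ratOp_gramMatrix (a : MonoidAlgebra ℤ G) (i j : Fin 1) :
    ratOp (gramMatrix a i j) = star (intOp a) * intOp a := by
  rw [gramMatrix, ratOp_map, ← intOpHom_apply, map_mul, intOpHom_apply, intOpHom_apply, star_intOp]

theorem matrixOp_gramMatrix_apply (a : MonoidAlgebra ℤ G) (v : L2 G) :
    matrixOp (gramMatrix a) (toL2Pow v) = toL2Pow ((star (intOp a) * intOp a) v) := by
  ext i
  simp [matrixOp, toL2Pow, ratOp_gramMatrix]

theorem zetaPow_eq (i : Fin 1) : zetaPow (G := G) i = toL2Pow (zeta 1) := by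
  ext j
  rw [Subsingleton.elim i 0, Subsingleton.elim j 0]
  simp [zetaPow, toL2Pow]

theorem matrixOp_gramMatrix_nonneg (a : MonoidAlgebra ℤ G) : 0 ≤ matrixOp (gramMatrix a) := by
  have h0 : (0 : L2 G →L[ℂ] L2 G) ≤ star (intOp a) * intOp a := star_mul_self_nonneg _
  have h := (ContinuousLinearMap.nonneg_iff_isPositive _).mp h0
  rw [ContinuousLinearMap.nonneg_iff_isPositive, ContinuousLinearMap.isPositive_iff]
  constructor
  · intro x y
    obtain ⟨u, rfl⟩ := toL2Pow_surjective x
    obtain ⟨v, rfl⟩ := toL2Pow_surjective y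
    simp only [ContinuousLinearMap.coe_coe, matrixOp_gramMatrix_apply, inner_toL2Pow]
    exact h.isSymmetric u v
  · intro x
    obtain ⟨u, rfl⟩ := toL2Pow_surjective x
    rw [matrixOp_gramMatrix_apply, inner_toL2Pow]
    exact h.inner_nonneg_left u

theorem norm_matrixOp_gramMatrix_le (a : MonoidAlgebra ℤ G) :
    ‖matrixOp (gramMatrix a)‖ ≤ normSq a := by
  refine ContinuousLinearMap.opNorm_le_bound _ (Nat.cast_nonneg _) fun x => ?_
  obtain ⟨u, rfl⟩ := toL2Pow_surjective x
  rw [matrixOp_gramMatrix_apply, norm_toL2Pow, norm_toL2Pow]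
  exact ContinuousLinearMap.le_of_opNorm_le _ (norm_star_mul_intOp_le a) u

theorem vectorTrace_gramMatrix (a : MonoidAlgebra ℤ G) (N : ℕ) :
    (vectorTrace (zetaPow (G := G))
      ((1 - (((normSq a : ℝ)⁻¹ : ℝ) : ℂ) • matrixOp (gramMatrix a)) ^ N)).re =
      complementTrace a N := by
  have h (v : L2 G) : ((1 - (((normSq a : ℝ)⁻¹ : ℝ) : ℂ) • matrixOp (gramMatrix a)) ^ N)
      (toL2Pow v) = toL2Pow (((1 - normalizedSquare a) ^ N) v) := by
    induction N generalizing v with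
    | zero => rfl
    | succ N ih =>
      rw [pow_succ, pow_succ]
      have h1 : (1 - (((normSq a : ℝ)⁻¹ : ℝ) : ℂ) • matrixOp (gramMatrix a)) (toL2Pow v) =
          toL2Pow ((1 - normalizedSquare a) v) := by
        change toL2Pow v - (((normSq a : ℝ)⁻¹ : ℝ) : ℂ) • (matrixOp (gramMatrix a) (toL2Pow v)) =
          toL2Pow (v - normalizedSquare a v)
        rw [matrixOp_gramMatrix_apply, normalizedSquare_eq]
        push_cast
        rfl
      change ((1 - (((normSq a : ℝ)⁻¹ : ℝ) : ℂ) • matrixOp (gramMatrix a)) ^ N)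
        ((1 - (((normSq a : ℝ)⁻¹ : ℝ) : ℂ) • matrixOp (gramMatrix a)) (toL2Pow v)) = _
      rw [h1, ih]
      rfl
  have h2 := vnTrace_eq_complementTrace a N
  rw [vnTrace] at h2
  rw [vectorTrace, Fin.sum_univ_one, zetaPow_eq, h, inner_toL2Pow, h2, Complex.ofReal_re]

/-- A kernel vector bounds the traces of the even powers of `1 - T` away from zero. -/
theorem exists_pos_le_complementTrace {a : MonoidAlgebra ℤ G} (ha : IsL2ZeroDivisor a) :
    ∃ c : ℝ, 0 < c ∧ ∀ j : ℕ, c ≤ complementTrace a (j + j) := by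
  obtain ⟨v, hv, hv1⟩ := ha.exists_apply_one_ne_zero
  have hv0 : v ≠ 0 := fun h => hv1 (by rw [h]; rfl)
  have hvn : 0 < ‖v‖ := norm_pos_iff.mpr hv0
  refine ⟨(‖(v : G → ℂ) 1‖ / ‖v‖) ^ 2, by positivity, fun j => ?_⟩
  set B : L2 G →L[ℂ] L2 G := 1 - normalizedSquare a with hB
  have hBv : (B ^ j) v = v := by
    have h1 : B v = v := by
      change v - normalizedSquare a v = v
      rw [(normalizedSquare_apply_eq_zero_iff a v).mpr hv, sub_zero]
    induction j with
    | zero => rfl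
    | succ j ih =>
      rw [pow_succ]
      change (B ^ j) (B v) = v
      rw [h1, ih]
  have hsa : IsSelfAdjoint (B ^ j) :=
    (IsSelfAdjoint.of_nonneg (sub_nonneg.mpr (normalizedSquare_le_one a))).pow j
  -- With `e` the unit of `G`, `|v(e)| = |⟨ζ_e, B^j v⟩| ≤ ‖B^j ζ_e‖ ‖v‖`, and
  -- `‖B^j ζ_e‖²` is the trace of `B^(2j)`.
  have hsym (x y : L2 G) : ⟪(B ^ j) x, y⟫_ℂ = ⟪x, (B ^ j) y⟫_ℂ := hsa.isSymmetric x y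
  have h1 : ‖(B ^ j) (zeta (1 : G))‖ ^ 2 = complementTrace a (j + j) := by
    have h2 := vnTrace_eq_complementTrace a (j + j)
    rw [vnTrace, ← hB, pow_add] at h2
    change ⟪zeta (1 : G), (B ^ j) ((B ^ j) (zeta 1))⟫_ℂ = _ at h2
    rw [← inner_self_eq_norm_sq (𝕜 := ℂ), hsym, h2]
    exact Complex.ofReal_re _
  have h3 : ‖(v : G → ℂ) 1‖ ≤ ‖(B ^ j) (zeta (1 : G))‖ * ‖v‖ := by
    rw [← inner_zeta_left, ← hBv, ← hsym, hBv]
    exact norm_inner_le_norm _ _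
  rw [← h1]
  refine pow_le_pow_left₀ (by positivity) ?_ 2
  rwa [div_le_iff₀ hvn]

/-- If `a` is an `ℓ²`-zero-divisor, its Gram matrix has a spectral atom at `0`. By the Atiyah
conjecture this atom has mass at least `1/k`, and it bounds all traces from below. -/
theorem inv_le_complementTrace {k : ℕ} (hk : IsAtomDenominator G k) {a : MonoidAlgebra ℤ G}
    (ha : IsL2ZeroDivisor a) (N : ℕ) : 1 / (k : ℝ) ≤ complementTrace a (N + 1) := by
  have hM : (0 : ℝ) < normSq a := by exact_mod_cast one_le_normSq a
  have hA := matrixOp_gramMatrix_nonneg a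
  have hAM := norm_matrixOp_gramMatrix_le a
  have hle := atom_le_vectorTrace (zetaPow (G := G)) hM N hA hAM
  have hlim := tendsto_vectorTrace_pow (zetaPow (G := G)) hM hA hAM
  simp only [vectorTrace_gramMatrix] at hle hlim
  refine le_trans ?_ hle
  obtain ⟨c, hc, hcj⟩ := exists_pos_le_complementTrace ha
  -- The bound by `c` holds for even exponents only, hence the subsequence.
  have hpos : c ≤ (spectralMeasure (zetaPow (G := G)) (matrixOp (gramMatrix a))).real {0} := by
    refine ge_of_tendsto' (hlim.comp (tendsto_atTop_mono (fun j => (by omega : j ≤ j + j + 1))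
      tendsto_id)) fun j => ?_
    have := hcj (j + 1)
    rwa [show j + 1 + (j + 1) = j + j + 1 + 1 by ring] at this
  obtain ⟨hk0, hk1⟩ := hk
  obtain ⟨p, hp⟩ := hk1 1 (gramMatrix a) (.of_nonneg hA) 0
  have hreal : (spectralMeasure (zetaPow (G := G)) (matrixOp (gramMatrix a))).real {0} =
      (p : ℝ) / k := by
    rw [measureReal_def]
    change (matrixSpectralMeasure (gramMatrix a) {0}).toReal = _
    rw [hp, ENNReal.toReal_div, ENNReal.toReal_natCast, ENNReal.toReal_natCast]
  rw [hreal] at hpos ⊢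
  have hk0' : (0 : ℝ) < k := by exact_mod_cast hk0
  have hp0 : p ≠ 0 := by
    rintro rfl
    simp at hpos
    linarith
  have : (1 : ℝ) ≤ p := by exact_mod_cast Nat.one_le_iff_ne_zero.mpr hp0
  exact div_le_div_of_nonneg_right this hk0'.le

end AtiyahBound

/-! ### The choice of the exponent -/

section Exponent
variable {G : Type u} [Group G]

/-- The exponent used in the decision procedure for group ring elements with `|a| ≤ L`, when `k` is
an atom denominator. The first two factors make the trace small for elements with trivial kernel;
the last one makes `3 |a|² / log N` small. -/
def exponent (k L : ℕ) : ℕ := 6 * k * L ^ (12 * k) * 3 ^ (9 * k * L ^ 2)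

theorem two_le_exponent {k L : ℕ} (hk : 0 < k) (hL : 0 < L) : 2 ≤ exponent k L := by
  have h1 : 0 < L ^ (12 * k) := Nat.pow_pos hL
  have h2 : 0 < 3 ^ (9 * k * L ^ 2) := by positivity
  have : 6 ≤ 6 * k * L ^ (12 * k) * 3 ^ (9 * k * L ^ 2) := by
    rw [mul_assoc, mul_assoc]
    exact Nat.le_mul_of_pos_right 6 (by positivity)
  unfold exponent
  omega

theorem div_log_exponent_lt {k L c : ℕ} (hk : 0 < k) (hL : 0 < L) (hc : c ≤ L) :
    3 * (c : ℝ) ^ 2 / Real.log (exponent k L) < 1 / (3 * (k : ℝ)) := by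
  have hk' : (0 : ℝ) < k := by exact_mod_cast hk
  have hL' : (0 : ℝ) < L := by exact_mod_cast hL
  have h3 : 1 < Real.log 3 := by
    rw [Real.lt_log_iff_exp_lt (by norm_num)]
    exact Real.exp_one_lt_d9.trans (by norm_num)
  have hge : ((3 : ℝ) ^ (9 * k * L ^ 2)) ≤ exponent k L := by
    have h1 : 0 < L ^ (12 * k) := Nat.pow_pos hL
    have : 3 ^ (9 * k * L ^ 2) ≤ exponent k L :=
      Nat.le_mul_of_pos_left _ (by positivity)
    exact_mod_cast this
  have hlog : 9 * (k : ℝ) * L ^ 2 < Real.log (exponent k L) := by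
    refine lt_of_lt_of_le ?_ (Real.log_le_log (by positivity) hge)
    rw [Real.log_pow]
    push_cast
    exact lt_mul_of_one_lt_right (by positivity) h3
  have hcL : (c : ℝ) ^ 2 ≤ (L : ℝ) ^ 2 := by
    have : (c : ℝ) ≤ L := by exact_mod_cast hc
    exact pow_le_pow_left₀ (Nat.cast_nonneg _) this 2
  have hpos : 0 < Real.log (exponent k L) := lt_trans (by positivity) hlog
  rw [div_lt_div_iff₀ hpos (by positivity)]
  nlinarith

theorem complementTrace_exponent_le {r : ℕ} {h : Fin r → G}
    (hgen : Subgroup.closure (Set.range h) = ⊤) (hs : HasSoficApproximations h)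
    {a : MonoidAlgebra ℤ G} (ha : ¬ IsL2ZeroDivisor a) {k L : ℕ} (hk : 0 < k) (hL : 2 ≤ L)
    (hc : coeffNorm a ≤ L) :
    complementTrace a (exponent k L) ≤ 1 / (3 * (k : ℝ)) := by
  have hk' : (0 : ℝ) < k := by exact_mod_cast hk
  have hL' : (2 : ℝ) ≤ L := by exact_mod_cast hL
  have hL0 : (0 : ℝ) < L := by linarith
  have hlogL : 0 < Real.log L := Real.log_pos (by linarith)
  -- `ε` is chosen so that `log M / log (1/ε) ≤ 1/(6k)`, and the exponent is at least `6k/ε`.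
  set ε : ℝ := 1 / (L : ℝ) ^ (12 * k) with hε
  have hε0 : 0 < ε := by positivity
  have hε1 : ε < 1 := by
    rw [hε, div_lt_one (by positivity)]
    exact one_lt_pow₀ (by linarith) (by omega)
  refine (complementTrace_le hgen hs ha hε0 hε1 _).trans ?_
  have h1 : Real.log (normSq a) / Real.log (1 / ε) ≤ 1 / (6 * k) := by
    have e1 : Real.log (1 / ε) = 12 * k * Real.log L := by
      rw [hε, one_div_one_div, Real.log_pow]; push_cast; ring
    have e2 : Real.log (normSq a) ≤ 2 * Real.log L := by
      have hle : normSq a ≤ L ^ 2 :=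
        max_le (Nat.pow_le_pow_left hc 2) (Nat.one_le_pow _ _ (by omega))
      have hpos : (0 : ℝ) < normSq a := by exact_mod_cast one_le_normSq a
      have := Real.log_le_log hpos (by exact_mod_cast hle : (normSq a : ℝ) ≤ (L : ℝ) ^ 2)
      rwa [Real.log_pow, Nat.cast_ofNat] at this
    rw [e1, div_le_div_iff₀ (by positivity) (by positivity)]
    nlinarith
  have h2 : (1 - ε) ^ exponent k L ≤ 1 / (6 * k) := by
    have hεN : 6 * (k : ℝ) ≤ ε * exponent k L := by
      have e : ε * exponent k L = 6 * k * 3 ^ (9 * k * L ^ 2) := by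
        rw [hε, exponent]
        push_cast
        field_simp
      rw [e]
      exact le_mul_of_one_le_right (by positivity) (one_le_pow₀ (by norm_num))
    calc (1 - ε) ^ exponent k L ≤ Real.exp (-ε) ^ exponent k L :=
          pow_le_pow_left₀ (by linarith) (Real.one_sub_le_exp_neg ε) _
      _ = (Real.exp (ε * exponent k L))⁻¹ := by
          rw [← Real.exp_nat_mul, ← Real.exp_neg]; congr 1; ring
      _ ≤ (6 * (k : ℝ))⁻¹ := by
          refine inv_anti₀ (by positivity) ?_
          linarith [Real.add_one_le_exp (ε * exponent k L)]
      _ = 1 / (6 * k) := by rw [one_div]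
  have h3 : 1 / (3 * (k : ℝ)) = 1 / (6 * k) + 1 / (6 * k) := by field_simp; norm_num
  rw [h3]
  exact add_le_add h1 h2

/-- For this `N`, the trace of `(1 - T)^N` is either at most `1/(3k)` or at least `1/k`, and this
decides whether `a` is an `ℓ²`-zero-divisor. -/
theorem isL2ZeroDivisor_iff (hsofic : IsSofic G) (hfg : (⊤ : Subgroup G).FG)
    {a : MonoidAlgebra ℤ G} {k L : ℕ}
    (hk : IsAtomDenominator G k) (hL : 2 ≤ L) (hc : coeffNorm a ≤ L) :
    IsL2ZeroDivisor a ↔ 1 / (3 * (k : ℝ)) < complementTrace a (exponent k L) := by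
  obtain ⟨r, h, hgen, hs⟩ := hsofic ⊤ hfg
  have hk' : (0 : ℝ) < k := by exact_mod_cast hk.1
  constructor
  · intro ha
    obtain ⟨N, hN⟩ : ∃ N, exponent k L = N + 1 :=
      ⟨exponent k L - 1, by have := two_le_exponent hk.1 (by omega : 0 < L); omega⟩
    rw [hN]
    refine lt_of_lt_of_le ?_ (inv_le_complementTrace hk ha N)
    exact one_div_lt_one_div_of_lt hk' (by linarith)
  · intro ha
    by_contra hn
    exact absurd (complementTrace_exponent_le hgen hs hn hk.1 hL hc) (not_le.mpr ha)

end Exponent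

/-! ### Computability of counting -/

section Count

theorem computable_countP {α β : Type*} [Primcodable α] [Primcodable β] {l : α → List β}
    {f : α → β → Bool} (hl : Computable l) (hf : Computable₂ f) :
    Computable fun a => (l a).countP (f a) := by
  have hstep : Computable₂ fun (a : α) (p : ℕ × ℕ) =>
      p.2 + Option.casesOn (l a)[p.1]? 0 fun b => cond (f a b) 1 0 := by
    refine Primrec.nat_add.to_comp.comp (Computable.snd.comp Computable.snd) ?_
    refine Computable.option_casesOn
      (Computable.list_getElem?.comp (hl.comp Computable.fst) (Computable.fst.comp Computable.snd))
      (Computable.const 0) ?_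
    exact Computable.cond
      (hf.comp (Computable.fst.comp Computable.fst) Computable.snd)
      (Computable.const 1) (Computable.const 0)
  refine (Computable.nat_rec (Computable.list_length.comp hl) (Computable.const 0) hstep).of_eq
    fun a => ?_
  have h (m : ℕ) : Nat.rec (motive := fun _ => ℕ) 0 (fun y IH =>
      IH + Option.casesOn (l a)[y]? 0 fun b => cond (f a b) 1 0) m =
      ((l a).take m).countP (f a) := by
    induction m with
    | zero => simp
    | succ m ih =>
      simp only [ih]
      rw [List.take_add_one, List.countP_append]
      rcases h : (l a)[m]? with _ | b
      · simp
      · cases hb : f a b <;> simp [hb]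
  rw [h, List.take_length]

end Count

/-! ### Formal sums of signed words -/

section Expressions
variable {n : ℕ}

/-- A signed word; the sign `true` is `+`. -/
abbrev SignedWord (n : ℕ) : Type := Bool × List (Fin n × Bool)

/-- The sign `±1` encoded by a Boolean. -/
def signValue (b : Bool) : ℤ := if b then 1 else -1

theorem signValue_beq (b c : Bool) : signValue (b == c) = signValue b * signValue c := by
  cases b <;> cases c <;> rfl

theorem signValue_not (b : Bool) : signValue (!b) = -signValue b := by
  cases b <;> rfl

variable {G : Type u} [Group G] (g : Fin n → G)

/-- The group element represented by a word. -/
def wordProd (u : List (Fin n × Bool)) : G := (u.map (letter g)).prod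

theorem wordProd_append (u v : List (Fin n × Bool)) :
    wordProd g (u ++ v) = wordProd g u * wordProd g v := by
  simp [wordProd]

/-- The element of the integral group ring represented by a formal sum of signed words. -/
def exprValue (l : List (SignedWord n)) : MonoidAlgebra ℤ G :=
  (l.map fun t => MonoidAlgebra.single (wordProd g t.2) (signValue t.1)).sum

theorem exprValue_nil : exprValue g [] = 0 := rfl

theorem exprValue_cons (t : SignedWord n) (l : List (SignedWord n)) :
    exprValue g (t :: l) = MonoidAlgebra.single (wordProd g t.2) (signValue t.1) +
      exprValue g l := rfl

theorem exprValue_append (l m : List (SignedWord n)) :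
    exprValue g (l ++ m) = exprValue g l + exprValue g m := by
  simp [exprValue]

/-! ### Reading words -/

/-- One step in reading a word. The state consists of the summands read so far, and of the sign and
the letters of the summand being read. -/
def parseStep (s : List (SignedWord n) × SignedWord n) (x : RingSymbol n) :
    List (SignedWord n) × SignedWord n :=
  Sum.casesOn x (fun y => (s.1, s.2.1, s.2.2 ++ [y]))
    fun t => if s.2.2 = [] then (s.1, s.2.1 == t, []) else (s.2 :: s.1, t, [])

/-- The summands read when the word ends in a given state; a summand without letters contributes
nothing. -/
def parseEnd (s : List (SignedWord n) × SignedWord n) : List (SignedWord n) :=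
  if s.2.2 = [] then s.1 else s.2 :: s.1

/-- The list of signed summands of a word in the letters and the symbols `+` and `-`. -/
def parse (w : List (RingSymbol n)) : List (SignedWord n) :=
  parseEnd (w.foldl parseStep ([], true, []))

theorem exprValue_parseEnd (w : List (RingSymbol n)) (l : List (SignedWord n)) (b : Bool)
    (u : List (Fin n × Bool)) :
    exprValue g (parseEnd (w.foldl parseStep (l, b, u))) = exprValue g l +
      readWord g (signValue b) (if u = [] then none else some (wordProd g u)) w := by
  induction w generalizing l b u with
  | nil =>
    by_cases hu : u = []
    · simp [parseEnd, hu, readWord]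
    · simp [parseEnd, hu, readWord, exprValue_cons, add_comm]
  | cons x w ih =>
    rw [List.foldl_cons]
    rcases x with x | t
    · have e : parseStep (l, b, u) (Sum.inl x) = (l, b, u ++ [x]) := rfl
      rw [e, ih, if_neg (by simp)]
      by_cases hu : u = []
      · simp [hu, readWord, wordProd]
      · simp [hu, readWord, wordProd]
    · by_cases hu : u = []
      · have e : parseStep (l, b, u) (Sum.inr t) = (l, b == t, []) := by simp [parseStep, hu]
        rw [e, ih, signValue_beq]
        simp [hu, readWord, signValue]
      · have e : parseStep (l, b, u) (Sum.inr t) = ((b, u) :: l, t, []) := by simp [parseStep, hu]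
        rw [e, ih, exprValue_cons]
        simp only [hu, if_true, if_false, readWord]
        rw [show signValue t = if t = true then 1 else -1 from rfl]
        abel

theorem exprValue_parse (w : List (RingSymbol n)) : exprValue g (parse w) = wordValue g w := by
  rw [parse, exprValue_parseEnd, exprValue_nil, zero_add]
  rfl

theorem primrec_parse : Primrec (parse : List (RingSymbol n) → List (SignedWord n)) := by
  have hend : Primrec (parseEnd : List (SignedWord n) × SignedWord n → List (SignedWord n)) :=
    Primrec.ite (Primrec.eq.comp (Primrec.snd.comp Primrec.snd) (Primrec.const []))
      Primrec.fst (Primrec.list_cons.comp Primrec.snd Primrec.fst)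
  have hstep : Primrec₂ (parseStep : List (SignedWord n) × SignedWord n → RingSymbol n → _) := by
    refine Primrec.sumCasesOn Primrec.snd ?_ ?_
    · have hs : Primrec fun p : ((List (SignedWord n) × SignedWord n) × RingSymbol n) ×
          (Fin n × Bool) => p.1.1 := Primrec.fst.comp Primrec.fst
      exact Primrec.pair (Primrec.fst.comp hs)
        (Primrec.pair (Primrec.fst.comp (Primrec.snd.comp hs))
          (Primrec.list_concat.comp (Primrec.snd.comp (Primrec.snd.comp hs)) Primrec.snd))
    · have hs : Primrec fun p : ((List (SignedWord n) × SignedWord n) × RingSymbol n) × Bool =>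
          p.1.1 := Primrec.fst.comp Primrec.fst
      refine Primrec.ite (Primrec.eq.comp (Primrec.snd.comp (Primrec.snd.comp hs))
        (Primrec.const [])) ?_ ?_
      · exact Primrec.pair (Primrec.fst.comp hs) (Primrec.pair
          (Primrec.beq.comp (Primrec.fst.comp (Primrec.snd.comp hs)) Primrec.snd)
          (Primrec.const []))
      · exact Primrec.pair (Primrec.list_cons.comp (Primrec.snd.comp hs) (Primrec.fst.comp hs))
          (Primrec.pair Primrec.snd (Primrec.const []))
  exact hend.comp (Primrec.list_foldl Primrec.id (Primrec.const ([], true, []))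
    (hstep.comp (Primrec.fst.comp Primrec.snd) (Primrec.snd.comp Primrec.snd)).to₂)

/-! ### Arithmetic of formal sums -/

/-- The formal inverse of a word, as a list. -/
def invWord (u : List (Fin n × Bool)) : List (Fin n × Bool) := (u.map fun x => (x.1, !x.2)).reverse

theorem wordProd_invWord (u : List (Fin n × Bool)) :
    wordProd g (invWord u) = (wordProd g u)⁻¹ := by
  simp only [wordProd, invWord]
  rw [List.prod_inv_reverse, List.map_reverse, List.map_map, List.map_map]
  congr 2
  exact List.map_congr_left fun x _ => letter_not g x

theorem primrec_invWord : Primrec (invWord : List (Fin n × Bool) → _) :=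
  Primrec.list_reverse.comp (Primrec.list_map Primrec.id
    (Primrec.pair (Primrec.fst.comp Primrec.snd)
      (Primrec.not.comp (Primrec.snd.comp Primrec.snd))).to₂)

/-- The product of a signed word with a formal sum. -/
def mulWord (s : SignedWord n) (m : List (SignedWord n)) : List (SignedWord n) :=
  m.map fun t => (s.1 == t.1, s.2 ++ t.2)

theorem exprValue_mulWord (s : SignedWord n) (m : List (SignedWord n)) :
    exprValue g (mulWord s m) =
      MonoidAlgebra.single (wordProd g s.2) (signValue s.1) * exprValue g m := by
  induction m with
  | nil => simp [mulWord, exprValue_nil]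
  | cons t m ih =>
    rw [exprValue_cons, mul_add, ← ih, MonoidAlgebra.single_mul_single, ← wordProd_append,
      ← signValue_beq]
    rfl

theorem primrec_mulWord :
    Primrec₂ (mulWord : SignedWord n → List (SignedWord n) → List (SignedWord n)) := by
  have hs : Primrec fun p : (SignedWord n × List (SignedWord n)) × SignedWord n => p.1.1 :=
    Primrec.fst.comp Primrec.fst
  exact Primrec.list_map Primrec.snd (Primrec.pair
    (Primrec.beq.comp (Primrec.fst.comp hs) (Primrec.fst.comp Primrec.snd))
    (Primrec.list_append.comp (Primrec.snd.comp hs) (Primrec.snd.comp Primrec.snd))).to₂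

/-- The product of two formal sums. -/
def mulExpr (l m : List (SignedWord n)) : List (SignedWord n) := l.flatMap fun s => mulWord s m

theorem exprValue_mulExpr (l m : List (SignedWord n)) :
    exprValue g (mulExpr l m) = exprValue g l * exprValue g m := by
  induction l with
  | nil => simp [mulExpr, exprValue_nil]
  | cons s l ih =>
    rw [exprValue_cons, add_mul, ← ih, ← exprValue_mulWord, ← exprValue_append]
    rfl

theorem primrec_mulExpr :
    Primrec₂ (mulExpr : List (SignedWord n) → List (SignedWord n) → List (SignedWord n)) :=
  Primrec.list_flatMap Primrec.fst
    (primrec_mulWord.comp Primrec.snd (Primrec.snd.comp Primrec.fst)).to₂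

/-- The involution on formal sums, composed with the sign change. -/
def negStarExpr (l : List (SignedWord n)) : List (SignedWord n) :=
  l.map fun t => (!t.1, invWord t.2)

theorem exprValue_negStarExpr (l : List (SignedWord n)) :
    exprValue g (negStarExpr l) = -involution (exprValue g l) := by
  induction l with
  | nil => simp [negStarExpr, exprValue_nil]
  | cons t l ih =>
    have e : negStarExpr (t :: l) = (!t.1, invWord t.2) :: negStarExpr l := rfl
    rw [e, exprValue_cons, exprValue_cons, ih, map_add, involution_single, neg_add,
      wordProd_invWord, signValue_not, MonoidAlgebra.single_neg]

theorem primrec_negStarExpr :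
    Primrec (negStarExpr : List (SignedWord n) → List (SignedWord n)) :=
  Primrec.list_map Primrec.id (Primrec.pair (Primrec.not.comp (Primrec.fst.comp Primrec.snd))
    (primrec_invWord.comp (Primrec.snd.comp Primrec.snd))).to₂

/-- A formal sum for `M - a* a`, where `a` is given by the formal sum `l`. -/
def complementExpr (M : ℕ) (l : List (SignedWord n)) : List (SignedWord n) :=
  ((List.range M).map fun _ => (true, [])) ++ mulExpr (negStarExpr l) l

theorem exprValue_complementExpr (M : ℕ) (l : List (SignedWord n)) :
    exprValue g (complementExpr M l) =
      (M : MonoidAlgebra ℤ G) - involution (exprValue g l) * exprValue g l := by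
  rw [complementExpr, exprValue_append, exprValue_mulExpr, exprValue_negStarExpr, neg_mul,
    ← sub_eq_add_neg]
  congr 1
  simp [exprValue, wordProd, signValue, ← MonoidAlgebra.one_def]

theorem primrec_complementExpr :
    Primrec₂ (complementExpr : ℕ → List (SignedWord n) → List (SignedWord n)) :=
  Primrec.list_append.comp
    (Primrec.list_map (Primrec.list_range.comp Primrec.fst) (Primrec.const (true, [])).to₂)
    (primrec_mulExpr.comp (primrec_negStarExpr.comp Primrec.snd) Primrec.snd)

/-- Powers of formal sums. -/
def powExpr (l : List (SignedWord n)) (N : ℕ) : List (SignedWord n) :=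
  Nat.rec [(true, [])] (fun _ acc => mulExpr acc l) N

theorem exprValue_powExpr (l : List (SignedWord n)) (N : ℕ) :
    exprValue g (powExpr l N) = exprValue g l ^ N := by
  induction N with
  | zero => simp [powExpr, exprValue, wordProd, signValue, ← MonoidAlgebra.one_def]
  | succ N ih => rw [pow_succ, ← ih, ← exprValue_mulExpr]; rfl

theorem primrec_powExpr :
    Primrec₂ (powExpr : List (SignedWord n) → ℕ → List (SignedWord n)) :=
  Primrec.nat_rec (f := fun _ => [(true, [])])
    (g := fun l (p : ℕ × List (SignedWord n)) => mulExpr p.2 l) (Primrec.const _)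
    (primrec_mulExpr.comp (Primrec.snd.comp Primrec.snd) Primrec.fst).to₂

/-! ### Traces and coefficient norms from the word problem -/

variable (W : List (Fin n × Bool) → Bool)

/-- The number of summands with sign `b` whose word is trivial according to `W`. -/
def trivialCount (b : Bool) (l : List (SignedWord n)) : ℕ :=
  l.countP fun t => (t.1 == b) && W t.2

variable {W} in
theorem computable_trivialCount (hW : Computable W) (b : Bool) :
    Computable (trivialCount W b) :=
  computable_countP Computable.id
    (Primrec.and.to_comp.comp
      (Primrec.beq.to_comp.comp (Computable.fst.comp Computable.snd) (Computable.const b))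
      (hW.comp (Computable.snd.comp Computable.snd))).to₂

variable {g W} in
theorem coeff_one_exprValue (hW : ∀ u, W u = true ↔ wordProd g u = 1)
    (l : List (SignedWord n)) :
    (exprValue g l).coeff 1 = (trivialCount W true l : ℤ) - trivialCount W false l := by
  classical
  induction l with
  | nil => simp [exprValue_nil, trivialCount]
  | cons t l ih =>
    obtain ⟨b, u⟩ := t
    rw [exprValue_cons, MonoidAlgebra.coeff_add, Finsupp.add_apply, ih, MonoidAlgebra.coeff_single,
      Finsupp.single_apply]
    simp only [trivialCount, List.countP_cons]
    by_cases hu : wordProd g u = 1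
    · have h1 : W u = true := (hW u).mpr hu
      cases b <;> simp [hu, h1, signValue] <;> ring
    · have h1 : W u = false := by rw [← Bool.not_eq_true, hW u]; exact hu
      simp [hu, h1]

/-- Whether the sign of the summand `t` agrees with the sign of the coefficient, in the sum `l`, of
the group element of `t`. -/
def signAgrees (l : List (SignedWord n)) (t : SignedWord n) : Bool :=
  decide (trivialCount W (!t.1) (mulWord (true, invWord t.2) l) <
    trivialCount W t.1 (mulWord (true, invWord t.2) l))

/-- The sum of the absolute values of the coefficients of a formal sum, as the number of summands
whose sign agrees with that of the coefficient of their group element, minus the number of those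
with the opposite sign; see `normExpr_eq`. -/
def normExpr (l : List (SignedWord n)) : ℕ :=
  l.countP (fun t => signAgrees W l t) - l.countP fun t => signAgrees W l (!t.1, t.2)

variable {W} in
theorem computable_signAgrees (hW : Computable W) : Computable₂ (signAgrees W) := by
  have hm : Computable fun p : List (SignedWord n) × SignedWord n =>
      mulWord (true, invWord p.2.2) p.1 :=
    (primrec_mulWord.comp (Primrec.pair (Primrec.const true)
      (primrec_invWord.comp (Primrec.snd.comp Primrec.snd))) Primrec.fst).to_comp
  have hb : Computable fun p : List (SignedWord n) × SignedWord n => p.2.1 :=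
    Computable.fst.comp Computable.snd
  have hc : Computable₂ fun (b : Bool) (m : List (SignedWord n)) => trivialCount W b m :=
    (Computable.cond Computable.fst ((computable_trivialCount hW true).comp Computable.snd)
      ((computable_trivialCount hW false).comp Computable.snd)).of_eq fun p => by
        rcases p with ⟨_ | _, m⟩ <;> rfl
  exact Primrec.nat_lt.decide.to_comp.comp (hc.comp (Primrec.not.to_comp.comp hb) hm)
    (hc.comp hb hm)

variable {W} in
theorem computable_normExpr (hW : Computable W) : Computable (normExpr W) := by
  have h := computable_signAgrees hW
  refine Primrec.nat_sub.to_comp.comp (computable_countP Computable.id h)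
    (computable_countP Computable.id ?_)
  exact h.comp Computable.fst (Computable.pair
    (Primrec.not.to_comp.comp (Computable.fst.comp Computable.snd))
    (Computable.snd.comp Computable.snd))

variable {g W} in
theorem signAgrees_iff (hW : ∀ u, W u = true ↔ wordProd g u = 1) (l : List (SignedWord n))
    (t : SignedWord n) :
    signAgrees W l t = true ↔ 0 < signValue t.1 * (exprValue g l).coeff (wordProd g t.2) := by
  -- Translating by the inverse word moves the coefficient of the group element to the unit.
  have h := coeff_one_exprValue hW (mulWord (true, invWord t.2) l)
  rw [exprValue_mulWord, MonoidAlgebra.coeff_single_mul_apply, wordProd_invWord] at h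
  simp only [inv_inv, mul_one, signValue, if_true, one_mul] at h
  rw [h, signAgrees, decide_eq_true_iff]
  rcases t with ⟨_ | _, u⟩ <;> simp [signValue]

/-- The coefficient norm of `a = ∑ s_i g_i` is `∑ s_i sgn(c_i)`, where `c_i` is the coefficient of
`g_i` in `a`: collecting the terms for `h ∈ G` gives `c_h sgn(c_h) = |c_h|`. -/
theorem coeffNorm_exprValue (l : List (SignedWord n)) :
    (coeffNorm (exprValue g l) : ℤ) =
      (l.map fun t => signValue t.1 * ((exprValue g l).coeff (wordProd g t.2)).sign).sum := by
  set a := exprValue g l with ha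
  have key (m : List (SignedWord n)) :
      ((exprValue g m).coeff.sum fun h c => c * (a.coeff h).sign) =
        (m.map fun t => signValue t.1 * (a.coeff (wordProd g t.2)).sign).sum := by
    induction m with
    | nil => simp [exprValue_nil]
    | cons t m ih =>
      rw [exprValue_cons, MonoidAlgebra.coeff_add,
        Finsupp.sum_add_index' (by simp) (by intros; ring), ih, MonoidAlgebra.coeff_single,
        Finsupp.sum_single_index (by simp), List.map_cons, List.sum_cons]
  rw [← key l, ← ha, coeffNorm, Finsupp.sum, Finsupp.sum]
  push_cast
  exact Finset.sum_congr rfl fun h _ => by rw [mul_comm, Int.sign_mul_self_eq_abs]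

variable {g W} in
theorem normExpr_eq (hW : ∀ u, W u = true ↔ wordProd g u = 1) (l : List (SignedWord n)) :
    normExpr W l = coeffNorm (exprValue g l) := by
  have key (m : List (SignedWord n)) :
      (m.map fun t => signValue t.1 * ((exprValue g l).coeff (wordProd g t.2)).sign).sum =
        (m.countP (fun t => signAgrees W l t) : ℤ) -
          m.countP fun t => signAgrees W l (!t.1, t.2) := by
    induction m with
    | nil => simp
    | cons t m ih =>
      rw [List.map_cons, List.sum_cons, ih, List.countP_cons, List.countP_cons]
      have h1 := signAgrees_iff hW l t
      have h2 := signAgrees_iff hW l (!t.1, t.2)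
      simp only [h1, h2, signValue_not]
      rcases lt_trichotomy ((exprValue g l).coeff (wordProd g t.2)) 0 with h | h | h
      · rcases t with ⟨_ | _, u⟩ <;>
          simp [signValue, Int.sign_eq_neg_one_of_neg h, h, h.not_gt] <;> ring
      · simp [h]
      · rcases t with ⟨_ | _, u⟩ <;>
          simp [signValue, Int.sign_eq_one_of_pos h, h, h.not_gt] <;> ring
  have h := coeffNorm_exprValue g l
  rw [key] at h
  rw [normExpr]
  omega

theorem coeffNorm_exprValue_le (l : List (SignedWord n)) :
    coeffNorm (exprValue g l) ≤ l.length := by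
  have h : (coeffNorm (exprValue g l) : ℤ) ≤ l.length := by
    rw [coeffNorm_exprValue]
    refine (List.sum_le_card_nsmul _ 1 fun x hx => ?_).trans (by simp)
    obtain ⟨t, _, rfl⟩ := List.mem_map.mp hx
    have h1 : |signValue t.1| = 1 := by cases t.1 <;> rfl
    refine (le_abs_self _).trans ?_
    rw [abs_mul, h1, one_mul]
    rcases Int.sign_trichotomy ((exprValue g l).coeff (wordProd g t.2)) with h | h | h <;>
      rw [h] <;> simp
  exact_mod_cast h

end Expressions

/-! ### The decision procedure -/

section Decision
variable {n : ℕ} {G : Type u} [Group G] {g : Fin n → G}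

theorem primrec_pow : Primrec₂ ((· ^ ·) : ℕ → ℕ → ℕ) :=
  Primrec₂.unpaired'.mp Nat.Primrec.pow

theorem primrec_exponent (k : ℕ) : Primrec (exponent k) :=
  Primrec.nat_mul.comp
    (Primrec.nat_mul.comp (Primrec.const _) (primrec_pow.comp Primrec.id (Primrec.const _)))
    (primrec_pow.comp (Primrec.const 3)
      (Primrec.nat_mul.comp (Primrec.const _) (primrec_pow.comp Primrec.id (Primrec.const 2))))

/-- The algorithm, for a given atom denominator. -/
theorem exists_computable_trace (hgen : Subgroup.closure (Set.range g) = ⊤)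
    (hsofic : IsSofic G) (hword : WordProblemDecidable g) {k : ℕ} (hk : IsAtomDenominator G k) :
    ∃ N p q : List (RingSymbol n) → ℕ, Computable N ∧ Computable p ∧ Computable q ∧
      ∀ w : List (RingSymbol n),
        2 ≤ N w ∧
        3 * (coeffNorm (wordValue g w) : ℝ) ^ 2 / Real.log (N w) < 1 / (3 * (k : ℝ)) ∧
        0 < q w ∧
        vnTrace ((1 - normalizedSquare (wordValue g w)) ^ (N w)) = (p w : ℂ) / (q w : ℂ) ∧
        (IsL2ZeroDivisor (wordValue g w) ↔ 1 / (3 * (k : ℝ)) < (p w : ℝ) / (q w : ℝ)) := by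
  obtain ⟨hdec, hcomp⟩ := hword
  set W : List (Fin n × Bool) → Bool := fun u => decide ((u.map (letter g)).prod = 1) with hWdef
  have hW (u : List (Fin n × Bool)) : W u = true ↔ wordProd g u = 1 := decide_eq_true_iff
  have hfg : (⊤ : Subgroup G).FG :=
    (Subgroup.fg_iff _).mpr ⟨Set.range g, hgen, Set.finite_range g⟩
  -- `L w` is a computable upper bound of `|w|`; it is at least `2` so that its logarithm is
  -- positive.
  let L : List (RingSymbol n) → ℕ := fun w => (parse w).length + 2
  let M : List (RingSymbol n) → ℕ := fun w => max (normExpr W (parse w) ^ 2) 1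
  let N : List (RingSymbol n) → ℕ := fun w => exponent k (L w)
  let e : List (RingSymbol n) → List (SignedWord n) := fun w =>
    powExpr (complementExpr (M w) (parse w)) (N w)
  have hparse : Computable (parse : List (RingSymbol n) → _) := primrec_parse.to_comp
  have hM : Computable M := Primrec.nat_max.to_comp.comp
    (primrec_pow.to_comp.comp ((computable_normExpr hcomp).comp hparse) (Computable.const 2))
    (Computable.const 1)
  have hN : Computable N := (primrec_exponent k).to_comp.comp
    (Primrec.nat_add.to_comp.comp (Computable.list_length.comp hparse) (Computable.const 2))
  have he : Computable e :=
    primrec_powExpr.to_comp.comp (primrec_complementExpr.to_comp.comp hM hparse) hN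
  have hMeq (w) : M w = normSq (wordValue g w) := by
    simp only [M, normSq, normExpr_eq hW, exprValue_parse]
  have hcL (w) : coeffNorm (wordValue g w) ≤ L w := by
    have := coeffNorm_exprValue_le g (parse w)
    rw [exprValue_parse] at this
    exact this.trans (Nat.le_add_right _ _)
  have hL2 (w) : 2 ≤ L w := Nat.le_add_left _ _
  have hcoeff (w) : (complementPow (wordValue g w) (N w)).coeff 1 =
      (trivialCount W true (e w) : ℤ) - trivialCount W false (e w) := by
    rw [← coeff_one_exprValue hW]
    simp only [e]
    rw [exprValue_powExpr, exprValue_complementExpr, exprValue_parse, hMeq]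
    rfl
  have hq0 (w) : 0 < M w ^ N w := Nat.pow_pos (by rw [hMeq]; exact one_le_normSq _)
  have htrace (w) : complementTrace (wordValue g w) (N w) =
      ((trivialCount W true (e w) - trivialCount W false (e w) : ℕ) : ℝ) /
        ((M w ^ N w : ℕ) : ℝ) := by
    have h0 := complementTrace_nonneg (wordValue g w) (N w)
    have hq : (0 : ℝ) < ((M w ^ N w : ℕ) : ℝ) := by exact_mod_cast hq0 w
    have h1 : complementTrace (wordValue g w) (N w) =
        ((complementPow (wordValue g w) (N w)).coeff 1 : ℝ) / ((M w ^ N w : ℕ) : ℝ) := by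
      rw [complementTrace, hMeq]; push_cast; rfl
    rw [h1] at h0 ⊢
    have h2 : 0 ≤ (complementPow (wordValue g w) (N w)).coeff 1 := by
      rw [le_div_iff₀ hq, zero_mul] at h0
      exact_mod_cast h0
    rw [hcoeff] at h2 ⊢
    rw [Nat.cast_sub (by omega)]
    push_cast
    rfl
  refine ⟨N, fun w => trivialCount W true (e w) - trivialCount W false (e w),
    fun w => M w ^ N w, hN, ?_, primrec_pow.to_comp.comp hM hN, fun w => ⟨?_, ?_, hq0 w, ?_, ?_⟩⟩
  · exact Primrec.nat_sub.to_comp.comp ((computable_trivialCount hcomp true).comp he)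
      ((computable_trivialCount hcomp false).comp he)
  · exact two_le_exponent hk.1 (by have := hL2 w; omega)
  · exact div_log_exponent_lt hk.1 (by have := hL2 w; omega) (hcL w)
  · rw [vnTrace_eq_complementTrace, htrace]
    push_cast
    rfl
  · rw [← htrace]
    exact isL2ZeroDivisor_iff hsofic hfg hk (hL2 w) (hcL w)

end Decision

end GroupL2

end

theorem mainTheorem2 {G : Type*} [Group G] {n : ℕ} (g : Fin n → G)
    (hgen : Subgroup.closure (Set.range g) = ⊤)
    (hsofic : GroupL2.IsSofic G)
    (hatiyah : GroupL2.SatisfiesAtiyah G)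
    (hword : GroupL2.WordProblemDecidable g) :
    ComputablePred (fun w : List (GroupL2.RingSymbol n) =>
        GroupL2.IsL2ZeroDivisor (GroupL2.wordValue g w)) ∧
      ∀ k : ℕ, GroupL2.IsAtomDenominator G k →
        ∃ N p q : List (GroupL2.RingSymbol n) → ℕ,
          Computable N ∧ Computable p ∧ Computable q ∧
          ∀ w : List (GroupL2.RingSymbol n),
            2 ≤ N w ∧
            3 * (GroupL2.coeffNorm (GroupL2.wordValue g w) : ℝ) ^ 2 / Real.log (N w)
              < 1 / (3 * (k : ℝ)) ∧
            0 < q w ∧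
            GroupL2.vnTrace
                ((1 - GroupL2.normalizedSquare (GroupL2.wordValue g w)) ^ (N w))
              = (p w : ℂ) / (q w : ℂ) ∧
            (GroupL2.IsL2ZeroDivisor (GroupL2.wordValue g w) ↔
              1 / (3 * (k : ℝ)) < (p w : ℝ) / (q w : ℝ)) := by
  refine ⟨?_, fun k hk => GroupL2.exists_computable_trace hgen hsofic hword hk⟩
  obtain ⟨k, hk⟩ := hatiyah
  obtain ⟨N, p, q, -, hp, hq, h⟩ := GroupL2.exists_computable_trace hgen hsofic hword hk
  have hiff (w : List (GroupL2.RingSymbol n)) :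
      q w < 3 * k * p w ↔ GroupL2.IsL2ZeroDivisor (GroupL2.wordValue g w) := by
    obtain ⟨-, -, hq0, -, hz⟩ := h w
    have hk0 : (0 : ℝ) < k := by exact_mod_cast hk.1
    have hq0' : (0 : ℝ) < q w := by exact_mod_cast hq0
    rw [hz, div_lt_div_iff₀ (by positivity) hq0', one_mul, mul_comm (p w : ℝ)]
    exact_mod_cast Iff.rfl
  refine ComputablePred.of_eq (p := fun w => q w < 3 * k * p w) ⟨inferInstance, ?_⟩ hiff
  exact Primrec.nat_lt.decide.to_comp.comp hq
    (Primrec.nat_mul.to_comp.comp (Computable.const (3 * k)) hp)
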